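/- **Setting.** A vocabulary $\tau$ is a finite set of relation symbols, each with an arity; $\tau$-structures $\mathcal A$ have a finite non-empty domain $V(\mathcal A)$, and $|\mathcal A| := |V(\mathcal A)|$. Write $[n]:=\{1,\dots,n\}$. Formulae of $\mathsf{LREC}_=[\tau]$ have domain variables, ranging over $V(\mathcal A)$, and number variables, ranging over $N(\mathcal A):=\{0,\dots,|\mathcal A|\}$. They are built from the atoms $R(\bar x)$, $x=y$, $\iota=\kappa$, $\iota\le\kappa$, $S(\iota,\kappa)$ (successor), $\min(\iota)$, $\max(\iota)$ by $\neg$, $\vee$, $\exists x$, $\exists\iota$, by the counting formulae $\#x\,\varphi=\kappa$ and $\#\iota\,\varphi=\kappa$ (the number of values of the bound variable that satisfy $\varphi$ equals the value of $\kappa$), and by the operator $$[\mathsf{lrec}_{\bar y_1,\bar y_2,\bar\iota}\ \varphi_=,\varphi_E,\varphi_C](\bar x,\bar\kappa),$$ where $\bar y_1,\bar y_2,\bar x$ are tuples of domain variables of the same length $\ell$, $\bar\iota,\bar\kappa$ are non-empty tuples of number variables, the variables in $\bar y_1\bar y_2$ are pairwise distinct, and so are those in $\bar\iota$. The operator binds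 $\bar y_1,\bar y_2$ in $\varphi_=$ and $\varphi_E$, and $\bar y_1,\bar\iota$ in $\varphi_C$. For $\bar i\in N(\mathcal A)^p$ let $\langle\bar i\rangle_{\mathcal A}:=\sum_{j=1}^{p} i_j(|\mathcal A|+1)^{j-1}$. Under an assignment $\alpha$, let $\sim$ be the equivalence relation on $V(\mathcal A)^\ell$ generated by the binary relation that $\varphi_=$ defines in the variables $\bar y_1,\bar y_2$. Let $\mathtt G$ be the directed graph whose vertices are the $\sim$-classes, with an edge from class $a$ to class $b$ iff $\varphi_E$ holds for some $\bar y_1\mapsto\bar v_1\in a$ and $\bar y_2\mapsto\bar v_2\in b$. Let $\mathtt C(a)$ be the set of all $\langle\bar i\rangle_{\mathcal A}$ such that $\varphi_C$ holds for $\bar y_1\mapsto\bar v'$, $\bar\iota\mapsto\bar i$ with some $\bar v'\in a$. Let $X$ be the set of pairs $(a,i)$ of a vertex $a$ and a natural number $i$ that is determined recursively by $$(a,i)\in X\iff i>0\ \text{ and }\ \Bigl|\Bigl\{b\in N^+_{\mathtt G}(a)\ :\ \bigl(b,\bigl\lfloor\tfrac{i-1}{\deg^-_{\mathtt G}(b)}\bigr\rfloor\bigr)\in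 X\Bigr\}\Bigr|\in\mathtt C(a).$$ The $\mathsf{lrec}$ formula holds iff $(\alpha(\bar x)/_\sim,\langle\alpha(\bar\kappa)\rangle_{\mathcal A})\in X$. The logic $\mathsf C[\tau]$ is first-order logic over $\tau$ extended by the counting quantifiers $\exists^{\ge m}x$ for $m\in\mathbb N$ (there are at least $m$ elements $x$). $\mathsf C^k_r$ is the set of its formulae that use only the variables $x_1,\dots,x_k$ (free or bound) and have quantifier depth at most $r$. **Theorem.** For every vocabulary $\tau$ and every $\mathsf{LREC}_=[\tau]$-formula $\varphi(\bar x,\bar\kappa)$, whose free domain variables are among the distinct variables $\bar x$ and whose free number variables are among the distinct variables $\bar\kappa$, there are a constant $k\in\mathbb N$ and a function $f:\mathbb N\to\mathbb N$ with $f(n)\in O(\log n)$ such that for every $n\in\mathbb N$ there is a family of $\mathsf C^k_{f(n)}[\tau]$-formulae $(\psi_{\bar m}(\bar x))_{\bar m\in[n]^{|\bar\kappa|}}$, with free variables among $\bar x$, such that for all $\tau$-structures $\mathcal A$ with $|\mathcal A|\le n$, all $\bar v\in V(\mathcal A)^{|\bar x|}$ and all $\bar m\in[|\mathcal A|]^{|\bar\kappa|}$,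 $$\mathcal A\models\varphi(\bar v,\bar m)\iff\mathcal A\models\psi_{\bar m}(\bar v).$$ -/

import Mathlib

universe u v w

/-! ### The logic `LREC₌`: syntax

Vocabularies are relational first-order languages `L`.  Domain variables `x₀, x₁, …` and number
variables `ι₀, ι₁, …` are both indexed by natural numbers.  -/

/-- Formulae of `LREC₌[L]`: first-order logic over the two-sorted structure `A⁺`, with counting
operators and the `lrec₌` operator.  Conjunction, universal quantifiers, etc. are abbreviations. -/
inductive LRecFormula (L : FirstOrder.Language.{u, v}) : Type v
  /-- `R(x̄)` -/
  | rel {a : ℕ} (R : L.Relations a) (x : Fin a → ℕ) : LRecFormula L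
  /-- `x = y` for domain variables -/
  | eqDom (x y : ℕ) : LRecFormula L
  /-- `ι = κ` for number variables -/
  | eqNum (ι κ : ℕ) : LRecFormula L
  /-- `ι ≤ κ` -/
  | le (ι κ : ℕ) : LRecFormula L
  /-- `S(ι, κ)`: `κ` is the successor of `ι` -/
  | succ (ι κ : ℕ) : LRecFormula L
  /-- `min(ι)` -/
  | isMin (ι : ℕ) : LRecFormula L
  /-- `max(ι)` -/
  | isMax (ι : ℕ) : LRecFormula L
  | neg (φ : LRecFormula L) : LRecFormula L
  | or (φ₁ φ₂ : LRecFormula L) : LRecFormula L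
  /-- `∃ x φ` for a domain variable `x` -/
  | exDom (x : ℕ) (φ : LRecFormula L) : LRecFormula L
  /-- `∃ ι φ` for a number variable `ι` -/
  | exNum (ι : ℕ) (φ : LRecFormula L) : LRecFormula L
  /-- `#x φ = κ` for a domain variable `x` -/
  | countDom (x : ℕ) (φ : LRecFormula L) (κ : ℕ) : LRecFormula L
  /-- `#ι φ = κ` for a number variable `ι` -/
  | countNum (ι : ℕ) (φ : LRecFormula L) (κ : ℕ) : LRecFormula L
  /-- `[lrec_{ȳ₁, ȳ₂, ῑ} φeq, φE, φC](x̄, κ̄)`; the variables bound by the operator are pairwise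
  distinct, and the number tuples `ῑ`, `κ̄` are non-empty. -/
  | lrec {k p q : ℕ} (y₁ y₂ : Fin k → ℕ) (ι : Fin p → ℕ) (φeq φE φC : LRecFormula L)
      (x : Fin k → ℕ) (κ : Fin q → ℕ)
      (hy : Function.Injective (Sum.elim y₁ y₂)) (hι : Function.Injective ι)
      (hp : 0 < p) (hq : 0 < q) : LRecFormula L

/-- The free domain variables of a formula. -/
def LRecFormula.freeDom {L : FirstOrder.Language.{u, v}} : LRecFormula L → Finset ℕ
  | .rel _ x => Finset.univ.image x
  | .eqDom x y => {x, y}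
  | .eqNum _ _ => ∅
  | .le _ _ => ∅
  | .succ _ _ => ∅
  | .isMin _ => ∅
  | .isMax _ => ∅
  | .neg φ => φ.freeDom
  | .or φ₁ φ₂ => φ₁.freeDom ∪ φ₂.freeDom
  | .exDom x φ => φ.freeDom \ {x}
  | .exNum _ φ => φ.freeDom
  | .countDom x φ _ => φ.freeDom \ {x}
  | .countNum _ φ _ => φ.freeDom
  | .lrec y₁ y₂ _ φeq φE φC x _ _ _ _ _ =>
      (φeq.freeDom \ (Finset.univ.image y₁ ∪ Finset.univ.image y₂)) ∪
      (φE.freeDom \ (Finset.univ.image y₁ ∪ Finset.univ.image y₂)) ∪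
      (φC.freeDom \ Finset.univ.image y₁) ∪ Finset.univ.image x

/-- The free number variables of a formula. -/
def LRecFormula.freeNum {L : FirstOrder.Language.{u, v}} : LRecFormula L → Finset ℕ
  | .rel _ _ => ∅
  | .eqDom _ _ => ∅
  | .eqNum ι κ => {ι, κ}
  | .le ι κ => {ι, κ}
  | .succ ι κ => {ι, κ}
  | .isMin ι => {ι}
  | .isMax ι => {ι}
  | .neg φ => φ.freeNum
  | .or φ₁ φ₂ => φ₁.freeNum ∪ φ₂.freeNum
  | .exDom _ φ => φ.freeNum
  | .exNum ι φ => φ.freeNum \ {ι}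
  | .countDom _ φ κ => φ.freeNum ∪ {κ}
  | .countNum ι φ κ => (φ.freeNum \ {ι}) ∪ {κ}
  | .lrec _ _ ι φeq φE φC _ κ _ _ _ _ =>
      φeq.freeNum ∪ φE.freeNum ∪ (φC.freeNum \ Finset.univ.image ι) ∪ Finset.univ.image κ

/-! ### The logic `LREC₌`: semantics -/

/-- The number domain `N(A) = {0, …, |A|}`. -/
noncomputable abbrev NumDom (A : Type w) : Type := Fin (Nat.card A + 1)

/-- The number `⟨ī⟩_A` that a tuple over `N(A)` represents in base `|A| + 1`
(least significant digit first). -/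
noncomputable def numVal {A : Type w} {p : ℕ} (i : Fin p → NumDom A) : ℕ :=
  ∑ j : Fin p, (i j : ℕ) * (Nat.card A + 1) ^ (j : ℕ)

/-- The in-degree of a vertex of the directed graph with edge relation `E`. -/
noncomputable def inDeg {V : Type w} (E : V → V → Prop) (b : V) : ℕ :=
  {a : V | E a b}.ncard

/-- The relation `X ⊆ V × ℕ` of limited recursion on the directed graph `(V, E)` with vertex
labelling `C`: `(a, i) ∈ X` iff `i > 0` and the number of out-neighbours `b` of `a` with
`(b, ⌊(i - 1) / deg⁻(b)⌋) ∈ X` lies in `C(a)`. -/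
def recX {V : Type w} (E : V → V → Prop) (C : V → Set ℕ) : ℕ → V → Prop
  | 0, _ => False
  | i + 1, a => {b : V | E a b ∧ recX E C (i / inDeg E b) b}.ncard ∈ C a
termination_by i => i
decreasing_by exact Nat.lt_succ_of_le (Nat.div_le_self _ _)

/-- The relation `X` of the `lrec₌` operator, for a graph on `T` with edge relation `E'` and
labelling `C'` that is contracted along the equivalence relation `∼` generated by `r`:
vertices are the `∼`-classes, edges are the images of the edges, and the label of a class is the
union of the labels of its members. -/
def lrecX {T : Type w} (r E' : T → T → Prop) (C' : T → Set ℕ) (i : ℕ) (t : T) : Prop :=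
  recX (V := Quotient (Relation.EqvGen.setoid r))
    (fun a b => ∃ s s' : T, Quotient.mk _ s = a ∧ Quotient.mk _ s' = b ∧ E' s s')
    (fun a => {c | ∃ s : T, Quotient.mk _ s = a ∧ c ∈ C' s})
    i (Quotient.mk _ t)

/-- `φ.Sat α β` is `(A⁺, (α, β)) ⊨ φ`, where `α` assigns values to the domain variables and
`β` to the number variables.  For injective `y`, `Function.extend y v α` is `α[v̄/ȳ]`. -/
def LRecFormula.Sat {L : FirstOrder.Language.{u, v}} {A : Type w} [L.Structure A] :
    LRecFormula L → (ℕ → A) → (ℕ → NumDom A) → Prop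
  | .rel R x, α, _ => FirstOrder.Language.Structure.RelMap R (fun j => α (x j))
  | .eqDom x y, α, _ => α x = α y
  | .eqNum ι κ, _, β => β ι = β κ
  | .le ι κ, _, β => β ι ≤ β κ
  | .succ ι κ, _, β => (β ι : ℕ) + 1 = β κ
  | .isMin ι, _, β => (β ι : ℕ) = 0
  | .isMax ι, _, β => (β ι : ℕ) = Nat.card A
  | .neg φ, α, β => ¬ φ.Sat α β
  | .or φ₁ φ₂, α, β => φ₁.Sat α β ∨ φ₂.Sat α β
  | .exDom x φ, α, β => ∃ a : A, φ.Sat (Function.update α x a) β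
  | .exNum ι φ, α, β => ∃ i : NumDom A, φ.Sat α (Function.update β ι i)
  | .countDom x φ κ, α, β => {a : A | φ.Sat (Function.update α x a) β}.ncard = β κ
  | .countNum ι φ κ, α, β => {i : NumDom A | φ.Sat α (Function.update β ι i)}.ncard = β κ
  | .lrec y₁ y₂ ι φeq φE φC x κ _ _ _ _, α, β =>
      lrecX
        (fun s s' => φeq.Sat (Function.extend y₂ s' (Function.extend y₁ s α)) β)
        (fun s s' => φE.Sat (Function.extend y₂ s' (Function.extend y₁ s α)) β)
        (fun s => {c | ∃ i : _ → NumDom A,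
          φC.Sat (Function.extend y₁ s α) (Function.extend ι i β) ∧ numVal i = c})
        (numVal (fun j => β (κ j))) (fun j => α (x j))

/-! ### First-order logic with counting quantifiers -/

/-- Formulae of the logic `C[L]`, with variables `x₀, x₁, …` indexed by natural numbers. -/
inductive CFormula (L : FirstOrder.Language.{u, v}) : Type v
  /-- `R(x̄)` -/
  | rel {a : ℕ} (R : L.Relations a) (x : Fin a → ℕ) : CFormula L
  /-- `x = y` -/
  | eq (x y : ℕ) : CFormula L
  | neg (φ : CFormula L) : CFormula L
  | or (φ₁ φ₂ : CFormula L) : CFormula L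
  /-- `∃ x φ` -/
  | ex (x : ℕ) (φ : CFormula L) : CFormula L
  /-- `∃^{≥ m} x φ` -/
  | exGe (m : ℕ) (x : ℕ) (φ : CFormula L) : CFormula L

/-- All variables occurring in a formula, free or bound. -/
def CFormula.vars {L : FirstOrder.Language.{u, v}} : CFormula L → Finset ℕ
  | .rel _ x => Finset.univ.image x
  | .eq x y => {x, y}
  | .neg φ => φ.vars
  | .or φ₁ φ₂ => φ₁.vars ∪ φ₂.vars
  | .ex x φ => φ.vars ∪ {x}
  | .exGe _ x φ => φ.vars ∪ {x}

/-- The free variables of a formula. -/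
def CFormula.free {L : FirstOrder.Language.{u, v}} : CFormula L → Finset ℕ
  | .rel _ x => Finset.univ.image x
  | .eq x y => {x, y}
  | .neg φ => φ.free
  | .or φ₁ φ₂ => φ₁.free ∪ φ₂.free
  | .ex x φ => φ.free \ {x}
  | .exGe _ x φ => φ.free \ {x}

/-- Quantifier depth. -/
def CFormula.qd {L : FirstOrder.Language.{u, v}} : CFormula L → ℕ
  | .rel _ _ => 0
  | .eq _ _ => 0
  | .neg φ => φ.qd
  | .or φ₁ φ₂ => max φ₁.qd φ₂.qd
  | .ex _ φ => φ.qd + 1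
  | .exGe _ _ φ => φ.qd + 1

/-- `ψ.InC k r`: the formula `ψ` belongs to the fragment `C^k_r`, i.e. it uses only the first `k`
variables and has quantifier depth at most `r`. -/
def CFormula.InC {L : FirstOrder.Language.{u, v}} (ψ : CFormula L) (k r : ℕ) : Prop :=
  ψ.vars ⊆ Finset.range k ∧ ψ.qd ≤ r

/-- `ψ.Sat α` is `(A, α) ⊨ ψ`. -/
def CFormula.Sat {L : FirstOrder.Language.{u, v}} {A : Type w} [L.Structure A] :
    CFormula L → (ℕ → A) → Prop
  | .rel R x, α => FirstOrder.Language.Structure.RelMap R (fun j => α (x j))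
  | .eq x y, α => α x = α y
  | .neg φ, α => ¬ φ.Sat α
  | .or φ₁ φ₂, α => φ₁.Sat α ∨ φ₂.Sat α
  | .ex x φ, α => ∃ a : A, φ.Sat (Function.update α x a)
  | .exGe m x φ, α => m ≤ {a : A | φ.Sat (Function.update α x a)}.ncard

/-! ### Determination by finitely many formulae of `C^K_r` -/

/-- Two finite types whose labellings have fibres of equal size are in a label-preserving
bijection. -/
theorem exists_equiv_of_card_fiber_eq {S T X : Type*} [Finite S] [Finite T] (p : S → X) (q : T → X)
    (h : ∀ x, Nat.card {s // p s = x} = Nat.card {t // q t = x}) :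
    ∃ f : S ≃ T, ∀ s, q (f s) = p s :=
  ⟨Equiv.ofFiberEquiv fun x => (Finite.card_eq.1 (h x)).some,
    fun s => Equiv.ofFiberEquiv_map _ s⟩

theorem card_fiber_eq_of_equiv {S T X : Type*} {p : S → X} {q : T → X} (f : S ≃ T)
    (h : ∀ s, q (f s) = p s) (x : X) : Nat.card {s // p s = x} = Nat.card {t // q t = x} :=
  Nat.card_congr (f.subtypeEquiv fun s => by rw [h])

/-- A finite non-empty `L`-structure with `N` elements. -/
structure FinStr (L : FirstOrder.Language.{u, v}) (N : ℕ) where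
  carrier : Type w
  [str : L.Structure carrier]
  [fin : Finite carrier]
  [nonempty : Nonempty carrier]
  card_eq : Nat.card carrier = N

instance (L : FirstOrder.Language.{u, v}) (N : ℕ) : CoeSort (FinStr.{u, v, w} L N) (Type w) :=
  ⟨FinStr.carrier⟩

attribute [instance] FinStr.str FinStr.fin FinStr.nonempty

variable {L : FirstOrder.Language.{u, v}} {N : ℕ}

theorem CFormula.InC.mono {ψ : CFormula L} {k k' r r' : ℕ} (h : ψ.InC k r) (hk : k ≤ k')
    (hr : r ≤ r') : ψ.InC k' r' :=
  ⟨h.1.trans (Finset.range_mono hk), h.2.trans hr⟩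

/-- Truth of a formula depends only on the variables that occur in it. -/
theorem CFormula.sat_congr {A : Type w} [L.Structure A] (ψ : CFormula L) {α α' : ℕ → A}
    (h : ∀ i ∈ ψ.vars, α i = α' i) : ψ.Sat α ↔ ψ.Sat α' := by
  induction ψ generalizing α α' with
  | rel R x =>
    have : (fun j => α (x j)) = fun j => α' (x j) := by
      funext j; exact h _ (by simp [CFormula.vars])
    simp [CFormula.Sat, this]
  | eq x y => simp [CFormula.Sat, h x (by simp [CFormula.vars]), h y (by simp [CFormula.vars])]
  | neg φ ih => exact not_congr (ih h)
  | or φ₁ φ₂ ih₁ ih₂ =>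
    simp only [CFormula.vars, Finset.mem_union] at h
    exact or_congr (ih₁ fun i hi => h i (.inl hi)) (ih₂ fun i hi => h i (.inr hi))
  | ex x φ ih =>
    simp only [CFormula.vars, Finset.mem_union] at h
    refine exists_congr fun a => ih fun i hi => ?_
    by_cases hx : i = x
    · simp [hx]
    · simp [hx, h i (.inl hi)]
  | exGe m x φ ih =>
    simp only [CFormula.vars, Finset.mem_union] at h
    have : ∀ a, φ.Sat (Function.update α x a) ↔ φ.Sat (Function.update α' x a) := by
      refine fun a => ih fun i hi => ?_
      by_cases hx : i = x
      · simp [hx]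
      · simp [hx, h i (.inl hi)]
    simp [CFormula.Sat, this]

/-- Substitution of variables among the first `K` ones, at no cost in quantifier depth. -/
theorem CFormula.exists_subst {K : ℕ} (ψ : CFormula L) (hψ : ψ.vars ⊆ Finset.range K) (σ : ℕ → ℕ)
    (hσ : ∀ i < K, σ i < K) :
    ∃ χ : CFormula L, χ.vars ⊆ Finset.range K ∧ χ.qd = ψ.qd ∧
      ∀ (A : Type w) [L.Structure A] (α : ℕ → A), χ.Sat α ↔ ψ.Sat (α ∘ σ) := by
  -- The other `K - 1` variables cannot have all `K` names as images under `σ`, so one name is left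
  -- for a bound variable and capture is avoided without extra variables.
  have fresh : ∀ (x : ℕ), x < K → ∀ σ : ℕ → ℕ, ∃ y < K, ∀ i < K, i ≠ x → σ i ≠ y := by
    intro x hx σ
    by_contra! hc
    have h1 : Finset.range K ⊆ ((Finset.range K).erase x).image σ := by
      intro y hy
      obtain ⟨i, hi, hix, rfl⟩ := hc y (Finset.mem_range.1 hy)
      exact Finset.mem_image_of_mem _ (by simp [hi, hix])
    have h2 := (Finset.card_le_card h1).trans Finset.card_image_le
    rw [Finset.card_erase_of_mem (Finset.mem_range.2 hx), Finset.card_range] at h2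
    omega
  have upd : ∀ {A : Type w} (x y : ℕ) (σ : ℕ → ℕ) (α : ℕ → A) (a : A),
      (∀ i < K, i ≠ x → σ i ≠ y) → ∀ i < K,
        (Function.update α y a ∘ Function.update σ x y) i = Function.update (α ∘ σ) x a i := by
    intro A x y σ α a h i hi
    by_cases hx : i = x
    · simp [hx]
    · simp [hx, h i hi hx]
  induction ψ generalizing σ with
  | rel R x =>
    refine ⟨.rel R (σ ∘ x), ?_, rfl, fun A _ α => Iff.rfl⟩
    intro i hi
    simp only [CFormula.vars, Finset.mem_image, Finset.mem_univ, true_and] at hi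
    obtain ⟨j, rfl⟩ := hi
    exact Finset.mem_range.2 (hσ _ (Finset.mem_range.1 (hψ (by simp [CFormula.vars]))))
  | eq x y =>
    refine ⟨.eq (σ x) (σ y), ?_, rfl, fun A _ α => Iff.rfl⟩
    intro i hi
    simp only [CFormula.vars, Finset.mem_insert, Finset.mem_singleton] at hi
    rcases hi with rfl | rfl <;>
      exact Finset.mem_range.2 (hσ _ (Finset.mem_range.1 (hψ (by simp [CFormula.vars]))))
  | neg φ ih =>
    obtain ⟨χ, h1, h2, h3⟩ := ih hψ σ hσ
    exact ⟨.neg χ, h1, h2, fun A _ α => not_congr (h3 A α)⟩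
  | or φ₁ φ₂ ih₁ ih₂ =>
    obtain ⟨χ, h1, h2, h3⟩ := ih₁ (Finset.union_subset_left hψ) σ hσ
    obtain ⟨χ', h1', h2', h3'⟩ := ih₂ (Finset.union_subset_right hψ) σ hσ
    exact ⟨.or χ χ', Finset.union_subset h1 h1', by simp [CFormula.qd, h2, h2'],
      fun A _ α => or_congr (h3 A α) (h3' A α)⟩
  | ex x φ ih =>
    have hx : x < K := Finset.mem_range.1 (hψ (by simp [CFormula.vars]))
    obtain ⟨y, hy, hfr⟩ := fresh x hx σ
    obtain ⟨χ, h1, h2, h3⟩ := ih (Finset.union_subset_left hψ) (Function.update σ x y) (by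
      intro i hi
      by_cases hix : i = x
      · simp [hix, hy]
      · simp [hix, hσ i hi])
    refine ⟨.ex y χ, Finset.union_subset h1 (by simpa using hy), by simp [CFormula.qd, h2],
      fun A _ α => exists_congr fun a => (h3 A _).trans (CFormula.sat_congr _ fun i hi => ?_)⟩
    exact upd x y σ α a hfr i (Finset.mem_range.1 (Finset.union_subset_left hψ hi))
  | exGe m x φ ih =>
    have hx : x < K := Finset.mem_range.1 (hψ (by simp [CFormula.vars]))
    obtain ⟨y, hy, hfr⟩ := fresh x hx σ
    obtain ⟨χ, h1, h2, h3⟩ := ih (Finset.union_subset_left hψ) (Function.update σ x y) (by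
      intro i hi
      by_cases hix : i = x
      · simp [hix, hy]
      · simp [hix, hσ i hi])
    refine ⟨.exGe m y χ, Finset.union_subset h1 (by simpa using hy), by simp [CFormula.qd, h2],
      fun A _ α => ?_⟩
    have : ∀ a, χ.Sat (Function.update α y a) ↔ φ.Sat (Function.update (α ∘ σ) x a) :=
      fun a => (h3 A _).trans (CFormula.sat_congr _ fun i hi =>
        upd x y σ α a hfr i (Finset.mem_range.1 (Finset.union_subset_left hψ hi)))
    simp [CFormula.Sat, this]

/-- `F` is determined by the truth values of finitely many formulae of `C^K_r`, uniformly in all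
structures with `N` elements. -/
def Determined (K r : ℕ) {X : Type*} (F : ∀ M : FinStr.{u, v, w} L N, (ℕ → M) → X) : Prop :=
  ∃ Ψ : Set (CFormula L), Ψ.Finite ∧ (∀ ψ ∈ Ψ, ψ.InC K r) ∧
    ∀ (M M' : FinStr.{u, v, w} L N) (α : ℕ → M) (α' : ℕ → M'),
      (∀ ψ ∈ Ψ, ψ.Sat α ↔ ψ.Sat α') → F M α = F M' α'

namespace Determined

variable {K r : ℕ} {X Y : Type*} {F : ∀ M : FinStr.{u, v, w} L N, (ℕ → M) → X}

theorem mono {K' r' : ℕ} (h : Determined K r F) (hK : K ≤ K') (hr : r ≤ r') :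
    Determined K' r' F := by
  obtain ⟨Ψ, h1, h2, h3⟩ := h
  exact ⟨Ψ, h1, fun ψ hψ => (h2 ψ hψ).mono hK hr, h3⟩

theorem of_sat (ψ : CFormula L) (hψ : ψ.InC K r) :
    Determined K r (fun (_ : FinStr.{u, v, w} L N) α => ψ.Sat α) :=
  ⟨{ψ}, Set.finite_singleton _, by simpa using hψ, fun M M' α α' h =>
    propext (h ψ (Set.mem_singleton _))⟩

theorem of_const (h : ∀ (M M' : FinStr.{u, v, w} L N) (α : ℕ → M) (α' : ℕ → M'),
    F M α = F M' α') : Determined K r F :=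
  ⟨∅, Set.finite_empty, by simp, fun M M' α α' _ => h M M' α α'⟩

theorem imp {G : ∀ M : FinStr.{u, v, w} L N, (ℕ → M) → Y} (hF : Determined K r F)
    (h : ∀ (M M' : FinStr.{u, v, w} L N) (α : ℕ → M) (α' : ℕ → M'),
      F M α = F M' α' → G M α = G M' α') : Determined K r G := by
  obtain ⟨Ψ, h1, h2, h3⟩ := hF
  exact ⟨Ψ, h1, h2, fun M M' α α' hs => h _ _ _ _ (h3 _ _ _ _ hs)⟩

theorem pi {ι : Type*} [Finite ι] {Z : ι → Type*}
    {F : ∀ i (M : FinStr.{u, v, w} L N), (ℕ → M) → Z i} (h : ∀ i, Determined K r (F i)) :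
    Determined K r (fun M α i => F i M α) := by
  choose Ψ h1 h2 h3 using h
  refine ⟨⋃ i, Ψ i, Set.finite_iUnion h1, ?_, fun M M' α α' hs => ?_⟩
  · intro ψ hψ
    obtain ⟨i, hi⟩ := Set.mem_iUnion.1 hψ
    exact h2 i ψ hi
  · funext i
    exact h3 i _ _ _ _ fun ψ hψ => hs ψ (Set.mem_iUnion_of_mem i hψ)

theorem prod {G : ∀ M : FinStr.{u, v, w} L N, (ℕ → M) → Y} (hF : Determined K r F)
    (hG : Determined K r G) : Determined K r (fun M α => (F M α, G M α)) := by
  obtain ⟨Ψ, h1, h2, h3⟩ := hF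
  obtain ⟨Ψ', h1', h2', h3'⟩ := hG
  exact ⟨Ψ ∪ Ψ', h1.union h1', fun ψ hψ => hψ.elim (h2 ψ) (h2' ψ), fun M M' α α' hs =>
    Prod.ext (h3 _ _ _ _ fun ψ hψ => hs ψ (.inl hψ)) (h3' _ _ _ _ fun ψ hψ => hs ψ (.inr hψ))⟩

theorem subst (hF : Determined K r F) (σ : ℕ → ℕ) (hσ : ∀ i < K, σ i < K) :
    Determined K r (fun M α => F M (α ∘ σ)) := by
  obtain ⟨Ψ, h1, h2, h3⟩ := hF
  have : ∀ ψ : CFormula L, ∃ χ : CFormula L, ψ ∈ Ψ → χ.InC K r ∧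
      ∀ (M : FinStr.{u, v, w} L N) (α : ℕ → M), χ.Sat α ↔ ψ.Sat (α ∘ σ) := by
    intro ψ
    by_cases hψ : ψ ∈ Ψ
    · obtain ⟨χ, c1, c2, c3⟩ := ψ.exists_subst (h2 ψ hψ).1 σ hσ
      exact ⟨χ, fun _ => ⟨⟨c1, c2.trans_le (h2 ψ hψ).2⟩, fun M α => c3 M α⟩⟩
    · exact ⟨ψ, fun h => absurd h hψ⟩
  choose f hf using this
  refine ⟨f '' Ψ, h1.image f, ?_, fun M M' α α' hs => h3 _ _ _ _ fun ψ hψ => ?_⟩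
  · rintro _ ⟨ψ, hψ, rfl⟩
    exact (hf ψ hψ).1
  · rw [← (hf ψ hψ).2, ← (hf ψ hψ).2]
    exact hs _ ⟨ψ, hψ, rfl⟩

end Determined

/-- The truth values of finitely many formulae are described by one formula. -/
theorem exists_pattern {K r : ℕ} (hK : 0 < K) {Ψ : Set (CFormula L)} (hf : Ψ.Finite)
    (hΨ : ∀ ψ ∈ Ψ, ψ.InC K r) (S : Set (CFormula L)) :
    ∃ χ : CFormula L, χ.InC K r ∧ ∀ (M : FinStr.{u, v, w} L N) (α : ℕ → M),
      χ.Sat α ↔ ∀ ψ ∈ Ψ, ψ.Sat α ↔ ψ ∈ S := by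
  induction Ψ, hf using Set.Finite.induction_on with
  | empty => exact ⟨.eq 0 0, ⟨by simpa [CFormula.vars] using hK, by simp [CFormula.qd]⟩,
      fun M α => by simp [CFormula.Sat]⟩
  | @insert ψ Ψ _ _ ih =>
    obtain ⟨χ, h1, h2⟩ := ih fun ψ hψ => hΨ ψ (.inr hψ)
    have hψ := hΨ ψ (.inl rfl)
    by_cases hS : ψ ∈ S
    · refine ⟨.neg (.or (.neg ψ) (.neg χ)), ⟨Finset.union_subset hψ.1 h1.1,
        max_le hψ.2 h1.2⟩, fun M α => ?_⟩
      simp [CFormula.Sat, h2, hS]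
    · refine ⟨.neg (.or ψ (.neg χ)), ⟨Finset.union_subset hψ.1 h1.1,
        max_le hψ.2 h1.2⟩, fun M α => ?_⟩
      simp [CFormula.Sat, h2, hS]

namespace Determined

variable {K r : ℕ} {X Y : Type*} {F : ∀ M : FinStr.{u, v, w} L N, (ℕ → M) → X}

/-- A determined property is defined by a formula. -/
theorem exists_formula (hK : 0 < K) {F : ∀ M : FinStr.{u, v, w} L N, (ℕ → M) → Prop}
    (hF : Determined K r F) : ∃ χ : CFormula L, χ.InC K r ∧
      ∀ (M : FinStr.{u, v, w} L N) (α : ℕ → M), F M α ↔ χ.Sat α := by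
  obtain ⟨Ψ, h1, h2, h3⟩ := hF
  choose pat hpat using exists_pattern.{u, v, w} (N := N) hK h1 h2
  -- The defining formula is the disjunction of the patterns realised together with `F`. It is
  -- obtained as the negation of the formula saying that all these patterns fail.
  let good : Set (Set (CFormula L)) :=
    {S | S ⊆ Ψ ∧ ∃ (M : FinStr.{u, v, w} L N) (α : ℕ → M), F M α ∧ ∀ ψ ∈ Ψ, ψ.Sat α ↔ ψ ∈ S}
  have hgood : good.Finite := h1.finite_subsets.subset fun S hS => hS.1
  obtain ⟨χ, c1, c2⟩ := exists_pattern.{u, v, w} (N := N) hK (hgood.image pat)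
    (r := r) (by rintro _ ⟨S, -, rfl⟩; exact (hpat S).1) ∅
  refine ⟨.neg χ, c1, fun M α => ?_⟩
  simp only [CFormula.Sat, c2, Set.forall_mem_image, Set.mem_empty_iff_false, iff_false, (hpat _).2]
  push Not
  constructor
  · intro h
    exact ⟨{ψ ∈ Ψ | ψ.Sat α}, ⟨fun ψ h => h.1, M, α, h, fun ψ hψ => by simp [hψ]⟩,
      fun ψ hψ => by simp [hψ]⟩
  · rintro ⟨S, ⟨-, M', α', hF', h'⟩, h⟩
    rw [h3 M M' α α' fun ψ hψ => (h ψ hψ).trans (h' ψ hψ).symm]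
    exact hF'

/-- Counting the values of one variable. -/
theorem count_var (hK : 0 < K) (hF : Determined K r F) {x : ℕ} (hx : x < K) :
    Determined K (r + 1) (fun M α (c : X) => Nat.card {a : M // F M (Function.update α x a) = c}) := by
  obtain ⟨Ψ, h1, h2, h3⟩ := hF
  choose pat hpat using exists_pattern.{u, v, w} (N := N) hK h1 h2
  -- Thresholds up to `N` suffice, since no set of elements of `M` is larger. Patterns are counted
  -- first; the counts for the values of `F` follow because a pattern fixes the value.
  refine ⟨(fun p : ℕ × Set (CFormula L) => .exGe p.1 x (pat p.2)) '' (Set.Iic N ×ˢ 𝒫 Ψ),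
    ((Set.finite_Iic N).prod h1.finite_subsets).image _, ?_, fun M M' α α' hs => ?_⟩
  · rintro _ ⟨p, -, rfl⟩
    exact ⟨Finset.union_subset (hpat _).1.1 (by simpa using hx),
      Nat.succ_le_succ (hpat _).1.2⟩
  · let p : ∀ (M : FinStr.{u, v, w} L N) (α : ℕ → M), M → Set (CFormula L) :=
      fun M α a => {ψ ∈ Ψ | ψ.Sat (Function.update α x a)}
    have hp : ∀ (M : FinStr.{u, v, w} L N) (α : ℕ → M) (S : Set (CFormula L)), S ⊆ Ψ →
        ∀ a, (pat S).Sat (Function.update α x a) ↔ p M α a = S := by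
      intro M α S hS a
      rw [(hpat S).2]
      constructor
      · intro h
        ext ψ
        constructor
        · rintro ⟨h1, h2⟩
          exact (h ψ h1).1 h2
        · exact fun h2 => ⟨hS h2, (h ψ (hS h2)).2 h2⟩
      · rintro rfl ψ hψ
        simp [p, hψ]
    have hcard : ∀ S, Nat.card {a // p M α a = S} = Nat.card {a // p M' α' a = S} := by
      intro S
      by_cases hS : S ⊆ Ψ
      · have key : ∀ m ≤ N, m ≤ Nat.card {a // p M α a = S} ↔ m ≤ Nat.card {a // p M' α' a = S} := by
          intro m hm
          have := hs _ ⟨(m, S), ⟨hm, hS⟩, rfl⟩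
          simpa only [CFormula.Sat, hp _ _ S hS, ← Nat.card_coe_set_eq, Set.coe_ofPred] using this
        have le : ∀ (M : FinStr.{u, v, w} L N) (α : ℕ → M),
            Nat.card {a // p M α a = S} ≤ N := fun M α =>
          (Finite.card_subtype_le _).trans_eq M.card_eq
        exact le_antisymm ((key _ (le M α)).1 le_rfl) ((key _ (le M' α')).2 le_rfl)
      · have : ∀ (M : FinStr.{u, v, w} L N) (α : ℕ → M), IsEmpty {a // p M α a = S} :=
          fun M α => ⟨fun a => hS (a.2 ▸ fun ψ h => h.1)⟩
        have e1 := this M α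
        have e2 := this M' α'
        simp
    obtain ⟨f, hf⟩ := exists_equiv_of_card_fiber_eq _ _ hcard
    funext c
    refine card_fiber_eq_of_equiv f (fun a => (h3 _ _ _ _ fun ψ hψ => ?_).symm) c
    have := congrArg (ψ ∈ ·) (hf a)
    simpa [p, hψ] using this.symm

/-- One move of the bijective pebble game: equal counts yield a bijection respecting `F`, and `G`
only has to be invariant under such bijections. -/
theorem exists_bij_var (hK : 0 < K) (hF : Determined K r F) {x : ℕ} (hx : x < K)
    {G : ∀ M : FinStr.{u, v, w} L N, (ℕ → M) → Y}
    (h : ∀ (M M' : FinStr.{u, v, w} L N) (α : ℕ → M) (α' : ℕ → M') (f : M ≃ M'),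
      (∀ a, F M' (Function.update α' x (f a)) = F M (Function.update α x a)) → G M α = G M' α') :
    Determined K (r + 1) G :=
  (hF.count_var hK hx).imp fun M M' α α' hc => by
    obtain ⟨f, hf⟩ := exists_equiv_of_card_fiber_eq _ _ (congrFun hc)
    exact h M M' α α' f hf

theorem extend_cons {A : Type*} {k : ℕ} (y : Fin (k + 1) → ℕ) (hy : Function.Injective y) (a : A)
    (s : Fin k → A) (α : ℕ → A) : Function.extend y (Fin.cons a s) α =
      Function.extend (y ∘ Fin.succ) s (Function.update α (y 0) a) := by
  have hy' : Function.Injective (y ∘ Fin.succ) := hy.comp (Fin.succ_injective k)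
  funext z
  by_cases hz : ∃ i, y i = z
  · obtain ⟨i, rfl⟩ := hz
    rw [hy.extend_apply]
    refine Fin.cases ?_ (fun i => ?_) i
    · rw [Function.extend_apply' (f := y ∘ Fin.succ) _ _ _
        (fun ⟨j, hj⟩ => Fin.succ_ne_zero j (hy hj))]
      simp
    · rw [show y i.succ = (y ∘ Fin.succ) i from rfl, hy'.extend_apply, Fin.cons_succ]
  · rw [Function.extend_apply' _ _ _ hz, Function.extend_apply' _ _ _
      (fun ⟨j, hj⟩ => hz ⟨_, hj⟩), Function.update_of_ne (fun h => hz ⟨0, h.symm⟩)]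

/-- Counting the values of a tuple of variables. -/
theorem count_tuple (hK : 0 < K) {k : ℕ} (y : Fin k → ℕ) (hy : Function.Injective y)
    (hyK : ∀ i, y i < K) (hF : Determined K r F) :
    Determined K (r + k)
      (fun M α (c : X) => Nat.card {s : Fin k → M // F M (Function.extend y s α) = c}) := by
  induction k with
  | zero =>
    refine hF.imp fun M M' α α' h => funext fun c => ?_
    have e : ∀ (M : FinStr.{u, v, w} L N) (α : ℕ → M) (s : Fin 0 → M),
        Function.extend y s α = α := fun M α s => funext fun z =>
      Function.extend_apply' _ _ _ fun ⟨i, _⟩ => i.elim0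
    refine card_fiber_eq_of_equiv (Equiv.ofUnique _ _) (fun s => ?_) c
    rw [e, e, h]
  | succ k ih =>
    have h1 := ih (y ∘ Fin.succ) (hy.comp (Fin.succ_injective k)) (fun i => hyK _)
    refine exists_bij_var hK h1 (hyK 0) fun M M' α α' f hf => funext fun c => ?_
    -- The bijection of the remaining coordinates depends on the first one, so the bijection of
    -- tuples is a sheared product.
    have : ∀ a, ∃ g : (Fin k → M) ≃ (Fin k → M'), ∀ s,
        F M' (Function.extend (y ∘ Fin.succ) (g s) (Function.update α' (y 0) (f a))) =
          F M (Function.extend (y ∘ Fin.succ) s (Function.update α (y 0) a)) := fun a =>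
      exists_equiv_of_card_fiber_eq _ _ (congrFun (hf a).symm)
    choose g hg using this
    let e : (Fin (k + 1) → M) ≃ (Fin (k + 1) → M') :=
      (Fin.consEquiv fun _ => M).symm.trans <|
        ((Equiv.prodShear f g)).trans (Fin.consEquiv fun _ => M')
    refine card_fiber_eq_of_equiv e (fun s => ?_) c
    have hs : Function.extend y s α = Function.extend (y ∘ Fin.succ) (Fin.tail s)
        (Function.update α (y 0) (s 0)) := by
      rw [← extend_cons y hy, Fin.cons_self_tail]
    have hs' : Function.extend y (e s) α' = Function.extend (y ∘ Fin.succ) (g (s 0) (Fin.tail s))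
        (Function.update α' (y 0) (f (s 0))) := by
      rw [← extend_cons y hy]
      rfl
    rw [hs, hs', hg]

theorem exists_bij_tuple (hK : 0 < K) {k : ℕ} (y : Fin k → ℕ) (hy : Function.Injective y)
    (hyK : ∀ i, y i < K) (hF : Determined K r F) {G : ∀ M : FinStr.{u, v, w} L N, (ℕ → M) → Y}
    (h : ∀ (M M' : FinStr.{u, v, w} L N) (α : ℕ → M) (α' : ℕ → M')
      (f : (Fin k → M) ≃ (Fin k → M')),
      (∀ s, F M' (Function.extend y (f s) α') = F M (Function.extend y s α)) → G M α = G M' α') :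
    Determined K (r + k) G :=
  (hF.count_tuple hK y hy hyK).imp fun M M' α α' hc => by
    obtain ⟨f, hf⟩ := exists_equiv_of_card_fiber_eq _ _ (congrFun hc)
    exact h M M' α α' f hf

end Determined

/-! ### Limited recursion by balanced certificates -/

section LimitedRecursion

variable {V : Type w}

theorem recX_zero (E : V → V → Prop) (C : V → Set ℕ) (a : V) : ¬ recX E C 0 a := by
  simp [recX]

theorem recX_pos (E : V → V → Prop) (C : V → Set ℕ) {i : ℕ} (hi : 0 < i) (a : V) :
    recX E C i a ↔ {b : V | E a b ∧ recX E C ((i - 1) / inDeg E b) b}.ncard ∈ C a := by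
  obtain ⟨i, rfl⟩ := Nat.exists_eq_add_of_lt hi
  rw [show 0 + i + 1 = i + 1 by omega, recX]
  simp

/-- `Cert E C m s h a i v` certifies in `s` rounds that the truth value of `(a, i) ∈ X` is `v`,
under the optional hypothesis `h = some (u, j, w)` that the truth value of `(u, j) ∈ X` is `w`.
Only pairs with second component below `m` serve as intermediate hypotheses. -/
def Cert (E : V → V → Prop) (C : V → Set ℕ) (m : ℕ) :
    ℕ → Option (V × ℕ × Bool) → V → ℕ → Bool → Prop
  | 0, h, a, i, v => h = some (a, i, v) ∨ (i = 0 ∧ v = false)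
  | s + 1, h, a, i, v => Cert E C m s h a i v ∨ ∃ (u : V) (j : ℕ) (w : Bool), j < m ∧ 0 < j ∧
      Cert E C m s (some (u, j, w)) a i v ∧
      (∀ c, E u c → ∃ w', Cert E C m s h c ((j - 1) / inDeg E c) w') ∧
      (w = true ↔ {c | E u c ∧ Cert E C m s h c ((j - 1) / inDeg E c) true}.ncard ∈ C u)

variable {E : V → V → Prop} {C : V → Set ℕ} {m : ℕ}

theorem Cert.mono {s s' : ℕ} {h : Option (V × ℕ × Bool)} {a : V} {i : ℕ} {v : Bool}
    (H : Cert E C m s h a i v) (hs : s ≤ s') : Cert E C m s' h a i v := by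
  induction hs with
  | refl => exact H
  | step _ ih => exact .inl ih

/-- A certified value is the true one if the hypothesis is. Every child carries a certificate for
some value, so a child without a certificate for `true` has value `false`, and the counted set is
the true one. -/
theorem Cert.sound {s : ℕ} {h : Option (V × ℕ × Bool)} {a : V} {i : ℕ} {v : Bool}
    (H : Cert E C m s h a i v) (hh : ∀ u j w, h = some (u, j, w) → (recX E C j u ↔ w = true)) :
    recX E C i a ↔ v = true := by
  induction s generalizing h a i v with
  | zero =>
    rcases H with H | ⟨rfl, rfl⟩
    · exact hh _ _ _ H
    · simp [recX_zero]
  | succ s ih =>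
    rcases H with H | ⟨u, j, w, -, hj, H1, H2, H3⟩
    · exact ih H hh
    · refine ih H1 ?_
      rintro u' j' w' he
      simp only [Option.some.injEq, Prod.mk.injEq] at he
      obtain ⟨rfl, rfl, rfl⟩ := he
      rw [recX_pos _ _ hj, H3]
      have : ∀ c, E u c → (recX E C ((j - 1) / inDeg E c) c ↔
          Cert E C m s h c ((j - 1) / inDeg E c) true) := by
        intro c hc
        constructor
        · intro hx
          obtain ⟨w', hw'⟩ := H2 c hc
          rwa [← (ih hw' hh).1 hx]
        · exact fun hx => (ih hx hh).2 rfl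
      rw [show {c | E u c ∧ recX E C ((j - 1) / inDeg E c) c} =
          {c | E u c ∧ Cert E C m s h c ((j - 1) / inDeg E c) true} from
          Set.ext fun c => and_congr_right (this c)]

/-- Not a matter of monotonicity, because the count is compared with an arbitrary set `C u`. The
count is unchanged: every child is already certified without the hypothesis, and by soundness a true
hypothesis cannot certify a different value. -/
theorem Cert.weaken {s : ℕ} {a : V} {i : ℕ} {v : Bool} (h : Option (V × ℕ × Bool))
    (hh : ∀ u j w, h = some (u, j, w) → (recX E C j u ↔ w = true))
    (H : Cert E C m s none a i v) : Cert E C m s h a i v := by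
  induction s generalizing a i v with
  | zero => exact .inr (H.resolve_left (by simp))
  | succ s ih =>
    rcases H with H | ⟨u, j, w, hm, hj, H1, H2, H3⟩
    · exact .inl (ih H)
    · refine .inr ⟨u, j, w, hm, hj, H1, fun c hc => (H2 c hc).imp fun _ => ih, ?_⟩
      rw [H3]
      have : ∀ c, E u c → (Cert E C m s none c ((j - 1) / inDeg E c) true ↔
          Cert E C m s h c ((j - 1) / inDeg E c) true) := by
        intro c hc
        refine ⟨ih, fun hx => ?_⟩
        obtain ⟨w', hw'⟩ := H2 c hc
        have e1 := hw'.sound (by simp)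
        have e2 := hx.sound hh
        rwa [← e1.1 (e2.2 rfl)]
      rw [show {c | E u c ∧ Cert E C m s none c ((j - 1) / inDeg E c) true} =
          {c | E u c ∧ Cert E C m s h c ((j - 1) / inDeg E c) true} from
          Set.ext fun c => and_congr_right (this c)]

/-! ### The weight of the recursion tree and balanced cutting -/

open Classical in
/-- A bound for the size of the recursion tree below `(a, i)`. -/
noncomputable def recWeight [Fintype V] (E : V → V → Prop) : ℕ → V → ℕ
  | 0, _ => 0
  -- A node is charged its resource rather than `1`; this makes the weight scale with the resource
  -- in `mul_recWeight_le`.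
  | i + 1, a => (i + 1) + ∑ b with E a b, recWeight E (i / inDeg E b) b
termination_by i => i
decreasing_by exact Nat.lt_succ_of_le (Nat.div_le_self _ _)

section
open Classical

variable [Fintype V]

theorem recWeight_zero (a : V) : recWeight E 0 a = 0 := by simp [recWeight]

theorem recWeight_pos {i : ℕ} (hi : 0 < i) (a : V) :
    recWeight E i a = i + ∑ b with E a b, recWeight E ((i - 1) / inDeg E b) b := by
  obtain ⟨i, rfl⟩ := Nat.exists_eq_add_of_lt hi
  rw [show 0 + i + 1 = i + 1 by omega, recWeight]
  simp

/-- The inequality passes to children: `d * ⌊(x - 1) / g⌋ * g ≤ d * x - d ≤ y - 1` for in-degree `g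
> 0` and `d > 0`; for `g = 0` the quotient is `0`. -/
theorem mul_recWeight_le {d x y : ℕ} (h : d * x ≤ y) (a : V) :
    d * recWeight E x a ≤ recWeight E y a := by
  induction y using Nat.strong_induction_on generalizing x a with
  | _ y ih =>
    rcases Nat.eq_zero_or_pos x with rfl | hx
    · simp [recWeight_zero]
    rcases Nat.eq_zero_or_pos d with rfl | hd
    · simp
    have hy : 0 < y := (Nat.mul_pos hd hx).trans_le h
    rw [recWeight_pos hx, recWeight_pos hy, mul_add, Finset.mul_sum]
    refine add_le_add h (Finset.sum_le_sum fun b _ => ih _ ?_ ?_ b)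
    · exact (Nat.div_le_self _ _).trans_lt (by omega)
    · rcases Nat.eq_zero_or_pos (inDeg E b) with h0 | hg
      · simp [h0]
      · rw [Nat.le_div_iff_mul_le hg, mul_assoc]
        calc d * ((x - 1) / inDeg E b * inDeg E b) ≤ d * (x - 1) :=
              Nat.mul_le_mul_left _ (Nat.div_mul_le_self _ _)
          _ = d * x - d := by rw [Nat.mul_sub, mul_one]
          _ ≤ y - 1 := by omega

/-- Summing over all vertices at once is essential: a vertex `b` occurs as a child `deg⁻(b)` times,
which the division by `deg⁻(b)` compensates, so the sum grows by at most `|V| * (i + 1)` from `i` to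
`i + 1`. -/
theorem sum_recWeight_le (i : ℕ) : ∑ a : V, recWeight E i a ≤ Fintype.card V * i ^ 2 := by
  induction i with
  | zero => simp [recWeight_zero]
  | succ i ih =>
    have h1 : ∑ a : V, recWeight E (i + 1) a =
        Fintype.card V * (i + 1) + ∑ b : V, inDeg E b * recWeight E (i / inDeg E b) b := by
      simp only [recWeight_pos (Nat.succ_pos i), Nat.succ_eq_add_one, Nat.add_sub_cancel,
        Finset.sum_add_distrib, Finset.sum_const, Finset.card_univ, smul_eq_mul,
        Finset.sum_filter]
      rw [Finset.sum_comm]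
      rw [← mul_add, add_left_cancel_iff]
      refine Finset.sum_congr rfl fun b _ => ?_
      rw [← Finset.sum_filter, Finset.sum_const, smul_eq_mul, inDeg, Set.ncard_eq_toFinset_card']
      simp
    have h2 : ∑ b : V, inDeg E b * recWeight E (i / inDeg E b) b ≤ ∑ b : V, recWeight E i b :=
      Finset.sum_le_sum fun b _ => mul_recWeight_le (Nat.mul_div_le _ _) b
    calc _ ≤ Fintype.card V * (i + 1) + Fintype.card V * i ^ 2 := by rw [h1]; omega
      _ = Fintype.card V * (i + 1 + i ^ 2) := by ring
      _ ≤ Fintype.card V * (i + 1) ^ 2 := Nat.mul_le_mul_left _ (by nlinarith)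

theorem recWeight_le (i : ℕ) (a : V) : recWeight E i a ≤ Fintype.card V * i ^ 2 :=
  (Finset.single_le_sum (s := Finset.univ) (f := fun a => recWeight E i a) (fun _ _ => Nat.zero_le _)
    (Finset.mem_univ a)).trans (sum_recWeight_le i)

/-- The step relation of the recursion on pairs `(a, i)`. -/
def RecStep (E : V → V → Prop) (t t' : V × ℕ) : Prop :=
  0 < t.2 ∧ E t.1 t'.1 ∧ t'.2 = (t.2 - 1) / inDeg E t'.1

theorem RecStep.weight_lt {t t' : V × ℕ} (h : RecStep E t t') :
    recWeight E t'.2 t'.1 < recWeight E t.2 t.1 := by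
  obtain ⟨h1, h2, h3⟩ := h
  rw [recWeight_pos h1, h3]
  have : recWeight E ((t.2 - 1) / inDeg E t'.1) t'.1 ≤
      ∑ b with E t.1 b, recWeight E ((t.2 - 1) / inDeg E b) b :=
    Finset.single_le_sum (f := fun b => recWeight E ((t.2 - 1) / inDeg E b) b)
      (fun _ _ => Nat.zero_le _) (Finset.mem_filter.2 ⟨Finset.mem_univ t'.1, h2⟩)
  omega

/-- Bounds the siblings of the child lying on the path to the hypothesis: what that child weighs is
not available to them. -/
theorem RecStep.weight_add_lt {t t' t'' : V × ℕ} (h : RecStep E t t') (h' : RecStep E t t'')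
    (hne : t'.1 ≠ t''.1) :
    recWeight E t'.2 t'.1 + recWeight E t''.2 t''.1 < recWeight E t.2 t.1 := by
  obtain ⟨h1, h2, h3⟩ := h
  obtain ⟨-, h2', h3'⟩ := h'
  rw [recWeight_pos h1, h3, h3', ← Finset.sum_pair
    (f := fun b => recWeight E ((t.2 - 1) / inDeg E b) b) hne]
  have : ∑ b ∈ {t'.1, t''.1}, recWeight E ((t.2 - 1) / inDeg E b) b ≤
      ∑ b with E t.1 b, recWeight E ((t.2 - 1) / inDeg E b) b :=
    Finset.sum_le_sum_of_subset (by
      intro b hb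
      simp only [Finset.mem_insert, Finset.mem_singleton] at hb
      rcases hb with rfl | rfl <;> simpa)
  omega

omit [Fintype V] in
theorem RecStep.snd_lt {t t' : V × ℕ} (h : RecStep E t t') : t'.2 < t.2 := by
  obtain ⟨h1, -, h3⟩ := h
  rw [h3]
  exact (Nat.div_le_self _ _).trans_lt (by omega)

theorem reflTransGen_recStep_weight {t t' : V × ℕ} (h : Relation.ReflTransGen (RecStep E) t t') :
    t = t' ∨ recWeight E t'.2 t'.1 < recWeight E t.2 t.1 := by
  induction h with
  | refl => exact .inl rfl
  | tail _ h ih =>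
    rcases ih with rfl | ih
    · exact .inr h.weight_lt
    · exact .inr (h.weight_lt.trans ih)

omit [Fintype V] in
theorem reflTransGen_recStep_snd_le {t t' : V × ℕ} (h : Relation.ReflTransGen (RecStep E) t t') :
    t'.2 ≤ t.2 := by
  induction h with
  | refl => exact le_rfl
  | tail _ h ih => exact h.snd_lt.le.trans ih

omit [Fintype V] in
/-- One round of certification with the true truth values. -/
theorem Cert.split {s : ℕ} {h : Option (V × ℕ × Bool)}
    (hh : ∀ u j w, h = some (u, j, w) → (recX E C j u ↔ w = true)) {t u : V × ℕ} {v : Bool}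
    (hu : u.2 < m) (hu0 : 0 < u.2)
    (h1 : Cert E C m s (some (u.1, u.2, decide (recX E C u.2 u.1))) t.1 t.2 v)
    (h2 : ∀ c, RecStep E u c → Cert E C m s h c.1 c.2 (decide (recX E C c.2 c.1))) :
    Cert E C m (s + 1) h t.1 t.2 v := by
  refine .inr ⟨u.1, u.2, _, hu, hu0, h1, fun c hc => ⟨_, h2 (c, (u.2 - 1) / inDeg E c) ⟨hu0, hc, rfl⟩⟩, ?_⟩
  rw [decide_eq_true_iff, recX_pos _ _ hu0]
  have : ∀ c, E u.1 c → (recX E C ((u.2 - 1) / inDeg E c) c ↔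
      Cert E C m s h c ((u.2 - 1) / inDeg E c) true) := by
    intro c hc
    refine ⟨fun hx => ?_, fun hx => (hx.sound hh).2 rfl⟩
    have := h2 (c, (u.2 - 1) / inDeg E c) ⟨hu0, hc, rfl⟩
    simpa only [decide_eq_true hx] using this
  rw [show {c | E u.1 c ∧ recX E C ((u.2 - 1) / inDeg E c) c} =
          {c | E u.1 c ∧ Cert E C m s h c ((u.2 - 1) / inDeg E c) true} from
          Set.ext fun c => and_congr_right (this c)]

/-- Certificates of logarithmic depth: for pairs `t` of weight below `2 ^ j`, and, from the value
at a descendant `t'`, for pairs whose weight exceeds that of `t'` by less than `2 ^ j`. -/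
theorem Cert.complete (E : V → V → Prop) (C : V → Set ℕ) (m j : ℕ) :
    (∀ t : V × ℕ, t.2 < m → recWeight E t.2 t.1 < 2 ^ j →
      Cert E C m (2 * j) none t.1 t.2 (decide (recX E C t.2 t.1))) ∧
    (∀ t t' : V × ℕ, t.2 < m → Relation.ReflTransGen (RecStep E) t t' →
      recWeight E t.2 t.1 < recWeight E t'.2 t'.1 + 2 ^ j →
      Cert E C m (2 * j) (some (t'.1, t'.2, decide (recX E C t'.2 t'.1))) t.1 t.2
        (decide (recX E C t.2 t.1))) := by
  induction j with
  | zero =>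
    constructor
    · rintro ⟨a, i⟩ _ ht
      rcases Nat.eq_zero_or_pos i with rfl | hi
      · exact .inr ⟨rfl, by simp [recX_zero]⟩
      · simp only [recWeight_pos hi] at ht
        omega
    · intro t t' _ hr ht
      rcases reflTransGen_recStep_weight hr with rfl | h
      · exact .inl rfl
      · omega
  | succ j ih =>
    obtain ⟨ihF, ihG⟩ := ih
    have hF : ∀ t : V × ℕ, t.2 < m → recWeight E t.2 t.1 < 2 ^ (j + 1) →
        Cert E C m (2 * j + 1) none t.1 t.2 (decide (recX E C t.2 t.1)) := by
      intro t htm ht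
      rcases Nat.eq_zero_or_pos t.2 with h0 | h0
      · have : Cert E C m 0 none t.1 t.2 (decide (recX E C t.2 t.1)) :=
          .inr ⟨h0, by simp [h0, recX_zero]⟩
        exact this.mono (Nat.zero_le _)
      -- `u` is a lightest descendant still within `2 ^ j` of the weight of `t`. By minimality each
      -- child of positive resource is at least `2 ^ j` lighter than `t`, hence lighter than `2 ^
      -- j`. Thus `t` follows from `u` by `ihG`, and the children are handled by `ihF`.
      obtain ⟨u, ⟨hu1, hu2, hu3⟩, hmin⟩ := WellFounded.has_min
        (measure fun t : V × ℕ => recWeight E t.2 t.1).wf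
        {u | Relation.ReflTransGen (RecStep E) t u ∧
          recWeight E t.2 t.1 < recWeight E u.2 u.1 + 2 ^ j ∧ 0 < u.2}
        ⟨t, .refl, by simp, h0⟩
      have hum := (reflTransGen_recStep_snd_le hu1).trans_lt htm
      refine Cert.split (by simp) hum hu3 (ihG t u htm hu1 hu2) fun c hc => ?_
      rcases Nat.eq_zero_or_pos c.2 with h0 | h0
      · have : Cert E C m 0 none c.1 c.2 (decide (recX E C c.2 c.1)) :=
          .inr ⟨h0, by simp [h0, recX_zero]⟩
        exact this.mono (Nat.zero_le _)
      refine ihF c (hc.snd_lt.trans hum) ?_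
      by_contra hlt
      refine hmin c ⟨hu1.tail hc, ?_, h0⟩ hc.weight_lt
      rw [pow_succ] at ht
      omega
    refine ⟨fun t htm ht => (hF t htm ht).mono (by omega), ?_⟩
    intro t t' htm hr ht
    by_cases htt : t = t'
    · subst htt
      have : Cert E C m 0 (some (t.1, t.2, decide (recX E C t.2 t.1))) t.1 t.2
        (decide (recX E C t.2 t.1)) := .inl rfl
      exact this.mono (Nat.zero_le _)
    -- The same choice, restricted to nodes strictly above `t'`, so that `u` has a child `u'` from
    -- which `t'` is reachable.
    obtain ⟨u, ⟨hu1, hu2, hu3⟩, hmin⟩ := WellFounded.has_min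
      (measure fun t : V × ℕ => recWeight E t.2 t.1).wf
      {u | Relation.ReflTransGen (RecStep E) t u ∧
        recWeight E t.2 t.1 < recWeight E u.2 u.1 + 2 ^ j ∧
        Relation.TransGen (RecStep E) u t'}
      ⟨t, .refl, by simp, (Relation.reflTransGen_iff_eq_or_transGen.1 hr).resolve_left
        fun h => htt h.symm⟩
    have hum := (reflTransGen_recStep_snd_le hu1).trans_lt htm
    obtain ⟨u', hu', hr'⟩ := Relation.TransGen.head'_iff.1 hu3
    have hh : ∀ u j w, some (t'.1, t'.2, decide (recX E C t'.2 t'.1)) = some (u, j, w) →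
        (recX E C j u ↔ w = true) := by
      intro u j w he
      simp only [Option.some.injEq, Prod.mk.injEq] at he
      obtain ⟨rfl, rfl, rfl⟩ := he
      simp
    have hwu : recWeight E u.2 u.1 ≤ recWeight E t.2 t.1 := by
      rcases reflTransGen_recStep_weight hu1 with rfl | h
      · exact le_rfl
      · exact h.le
    have hwu' : recWeight E t'.2 t'.1 ≤ recWeight E u'.2 u'.1 := by
      rcases reflTransGen_recStep_weight hr' with rfl | h
      · exact le_rfl
      · exact h.le
    refine Cert.split hh hum hu'.1 ((ihG t u htm hu1 hu2).mono (Nat.le_succ _)) fun c hc => ?_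
    by_cases hcu : c.1 = u'.1
    -- A child is determined by its vertex. By minimality `u'` is `t'` or at least `2 ^ j` lighter
    -- than `t`; in both cases it exceeds `t'` by less than `2 ^ j`.
    · have hcu2 : c = u' := Prod.ext hcu (by rw [hc.2.2, hu'.2.2, hcu])
      subst hcu2
      refine (ihG c t' (hc.snd_lt.trans hum) hr' ?_).mono (Nat.le_succ _)
      by_contra hlt
      rcases Relation.reflTransGen_iff_eq_or_transGen.1 hr' with rfl | hr''
      · exact hlt (by simp)
      · refine hmin c ⟨hu1.tail hc, ?_, hr''⟩ hc.weight_lt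
        rw [pow_succ] at ht
        omega
    -- Any other child shares the weight of `u` with `u'`, which weighs at least as much as `t'`; so
    -- less than `2 ^ (j + 1)` remains. Such children do not need the hypothesis, and `hF` takes
    -- only `2 * j + 1` rounds, leaving one for the cut at `u`.
    · refine Cert.weaken _ hh (hF c (hc.snd_lt.trans hum) ?_)
      have := hc.weight_add_lt hu' hcu
      omega

end

/-- Limited recursion has certificates of depth logarithmic in the number of vertices and in the
resource bound. -/
theorem recX_iff_cert [Finite V] (E : V → V → Prop) (C : V → Set ℕ) {m j i : ℕ} (hi : i < m)
    (hj : Nat.card V * m ^ 2 ≤ 2 ^ j) (a : V) :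
    recX E C i a ↔ Cert E C m (2 * j) none a i true := by
  classical
  refine ⟨fun h => ?_, fun h => (h.sound (by simp)).2 rfl⟩
  have := Fintype.ofFinite V
  have hw : recWeight E i a < 2 ^ j := by
    refine (recWeight_le i a).trans_lt (lt_of_lt_of_le ?_ hj)
    rw [Nat.card_eq_fintype_card]
    have : Nonempty V := ⟨a⟩
    exact Nat.mul_lt_mul_of_pos_left (Nat.pow_lt_pow_left hi (by simp)) Fintype.card_pos
  have := (Cert.complete E C m j).1 (a, i) hi hw
  simpa only [decide_eq_true h] using this

end LimitedRecursion

/-! ### Generated equivalence relations by repeated squaring -/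

/-- Paths of length at most `2 ^ j` in the symmetric closure of `R`. -/
def squarePath {T : Type w} (R : T → T → Prop) : ℕ → T → T → Prop
  | 0, s, t => s = t ∨ R s t ∨ R t s
  | j + 1, s, t => ∃ z, squarePath R j s z ∧ squarePath R j z t

/-- A path visits each vertex at most once, so its length is below `Nat.card T ≤ 2 ^ j`, and it can
be halved `j` times. Equality in the base case allows shorter paths and accounts for loops of `R`,
which the simple graph omits. -/
theorem squarePath_iff {T : Type w} [Finite T] (R : T → T → Prop) {j : ℕ}
    (hj : Nat.card T ≤ 2 ^ j) (s t : T) : squarePath R j s t ↔ Relation.EqvGen R s t := by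
  classical
  have := Fintype.ofFinite T
  constructor
  · intro h
    clear hj
    induction j generalizing s t with
    | zero =>
      rcases h with rfl | h | h
      · exact .refl _
      · exact .rel _ _ h
      · exact .symm _ _ (.rel _ _ h)
    | succ j ih =>
      obtain ⟨z, h1, h2⟩ := h
      exact .trans _ _ _ (ih _ _ h1) (ih _ _ h2)
  · intro h
    have hr : (SimpleGraph.fromRel R).Reachable s t := by
      induction h with
      | rel x y h =>
        by_cases hxy : x = y
        · subst hxy; rfl
        · exact SimpleGraph.Adj.reachable (by simp [hxy, h])
      | refl x => rfl
      | symm x y _ ih => exact ih.symm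
      | trans x y z _ _ ih1 ih2 => exact ih1.trans ih2
    have key : ∀ (j : ℕ) (s t : T) (p : (SimpleGraph.fromRel R).Walk s t),
        p.length ≤ 2 ^ j → squarePath R j s t := by
      intro j
      induction j with
      | zero =>
        intro s t p hp
        rcases Nat.lt_or_ge p.length 1 with h | h
        · exact .inl (SimpleGraph.Walk.eq_of_length_eq_zero (p := p) (by omega))
        · have := SimpleGraph.Walk.adj_of_length_eq_one (p := p) (by rw [pow_zero] at hp; omega)
          exact .inr (by simpa using this.2)
      | succ j ih =>
        intro s t p hp
        refine ⟨p.getVert (2 ^ j), ih _ _ (p.take (2 ^ j)) ?_, ih _ _ (p.drop (2 ^ j)) ?_⟩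
        · rw [SimpleGraph.Walk.take_length]; omega
        · rw [SimpleGraph.Walk.drop_length]; rw [pow_succ] at hp; omega
    obtain ⟨p⟩ := hr
    refine key j s t p.toPath.1 (p.toPath.2.length_lt.le.trans ?_)
    rwa [← Nat.card_eq_fintype_card]

/-! ### Counting classes -/

open Classical in
/-- The number of classes with a property, as a sum over elements weighted by the reciprocals of
the sizes of their classes. -/
theorem ncard_classes_eq_sum {S : Type*} [Fintype S] (rS : Setoid S) (P : Quotient rS → Prop) :
    (({a | P a}.ncard : ℕ) : ℚ) =
      ∑ s : S, if P (Quotient.mk _ s) then (1 / ({s' | rS s' s}.ncard : ℚ)) else 0 := by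
  have := Fintype.ofFinite (Quotient rS)
  rw [← Finset.sum_fiberwise (s := Finset.univ) (g := fun s : S => (Quotient.mk rS s))]
  have h1 : ∀ a : Quotient rS, (∑ s : S with Quotient.mk rS s = a,
      if P (Quotient.mk _ s) then (1 / ({s' | rS s' s}.ncard : ℚ)) else 0) =
      if P a then 1 else 0 := by
    intro a
    obtain ⟨s₀, rfl⟩ := Quotient.exists_rep a
    have h2 : ∀ s ∈ Finset.univ.filter (fun s : S => Quotient.mk rS s = Quotient.mk rS s₀),
        (if P (Quotient.mk _ s) then (1 / ({s' | rS s' s}.ncard : ℚ)) else 0) =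
        if P (Quotient.mk _ s₀) then (1 / ({s' | rS s' s₀}.ncard : ℚ)) else 0 := by
      intro s hs
      have hs := (Finset.mem_filter.1 hs).2
      have e : {s' | rS s' s} = {s' | rS s' s₀} := by
        ext s'
        exact ⟨fun h => rS.trans h (Quotient.exact hs),
          fun h => rS.trans h (rS.symm (Quotient.exact hs))⟩
      rw [hs, e]
    rw [Finset.sum_congr rfl h2, Finset.sum_const]
    have e : (Finset.univ.filter (fun s : S => Quotient.mk rS s = Quotient.mk rS s₀)).card =
        {s' | rS s' s₀}.ncard := by
      rw [Set.ncard_eq_toFinset_card']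
      congr 1
      ext s
      simp [Quotient.eq]
    have hne : (({s' | rS s' s₀}.ncard : ℕ) : ℚ) ≠ 0 := by
      rw [Nat.cast_ne_zero]
      exact Set.ncard_ne_zero_of_mem (a := s₀) (rS.refl s₀)
    rw [e]
    split_ifs
    · rw [nsmul_eq_mul]; field_simp
    · simp
  rw [Finset.sum_congr rfl fun a _ => h1 a, Finset.sum_boole, Set.ncard_eq_toFinset_card']
  simp

/-- The number of classes with a property is determined by the elements with the property and the
sizes of their classes. -/
theorem ncard_classes_eq {S T : Type*} [Finite S] [Finite T] (rS : Setoid S) (rT : Setoid T)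
    (f : S ≃ T) (P : Quotient rS → Prop) (Q : Quotient rT → Prop)
    (hPQ : ∀ s, Q (Quotient.mk _ (f s)) ↔ P (Quotient.mk _ s))
    (hsize : ∀ s, {t | rT t (f s)}.ncard = {s' | rS s' s}.ncard) :
    {a | P a}.ncard = {b | Q b}.ncard := by
  classical
  have := Fintype.ofFinite S
  have := Fintype.ofFinite T
  have h : (({a | P a}.ncard : ℕ) : ℚ) = (({b | Q b}.ncard : ℕ) : ℚ) := by
    rw [ncard_classes_eq_sum rS P, ncard_classes_eq_sum rT Q, ← Equiv.sum_comp f]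
    refine Finset.sum_congr rfl fun s _ => ?_
    simp only [hPQ, hsize]
  exact_mod_cast h

/-! ### Determination relative to blocks of variables -/

/-- The `i`-th variable of the `j`-th of five blocks of `k` variables after the first `K₀` ones. -/
def blockVar (K₀ k : ℕ) (p : Fin 5 × Fin k) : ℕ := K₀ + finProdFinEquiv p

/-- The identity on the first `K₀` variables. -/
def baseVar (K₀ : ℕ) (i : ℕ) : ℕ := if i < K₀ then i else 0

theorem blockVar_injective (K₀ k : ℕ) : Function.Injective (blockVar K₀ k) := by
  intro p q h
  exact finProdFinEquiv.injective (Fin.ext (Nat.add_left_cancel h))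

theorem blockVar_lt (K₀ k : ℕ) (p : Fin 5 × Fin k) : blockVar K₀ k p < K₀ + 5 * k :=
  Nat.add_lt_add_left (finProdFinEquiv p).2 _

theorem baseVar_lt {K₀ : ℕ} (h : 0 < K₀) (i : ℕ) : baseVar K₀ i < K₀ := by
  unfold baseVar
  split_ifs <;> omega

theorem baseVar_baseVar {K₀ : ℕ} (h : 0 < K₀) (i : ℕ) :
    baseVar K₀ (baseVar K₀ i) = baseVar K₀ i :=
  if_pos (baseVar_lt h i)

theorem blockVar_ne_baseVar {K₀ : ℕ} (h : 0 < K₀) {k : ℕ} (p : Fin 5 × Fin k) (i : ℕ) :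
    blockVar K₀ k p ≠ baseVar K₀ i := by
  have := baseVar_lt h i
  unfold blockVar
  omega

/-- `F`, a function of an assignment and of five `k`-tuples, is determined by finitely many
formulae in which `K₀` variables stand for the assignment and blocks of `k` variables for the
tuples. -/
def BlockDet (K₀ : ℕ) {k : ℕ} (r : ℕ) {X : Type*}
    (F : ∀ M : FinStr.{u, v, w} L N, (ℕ → M) → (Fin 5 → Fin k → M) → X) : Prop :=
  Determined (K₀ + 5 * k) r
    (fun M γ => F M (γ ∘ baseVar K₀) (fun j i => γ (blockVar K₀ k (j, i))))

namespace BlockDet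

variable {K₀ k r : ℕ} {X Y : Type*}
  {F : ∀ M : FinStr.{u, v, w} L N, (ℕ → M) → (Fin 5 → Fin k → M) → X}
  {G : ∀ M : FinStr.{u, v, w} L N, (ℕ → M) → (Fin 5 → Fin k → M) → Y}

theorem mono {r' : ℕ} (h : BlockDet K₀ r F) (hr : r ≤ r') : BlockDet K₀ r' F :=
  Determined.mono h le_rfl hr

theorem imp (hF : BlockDet K₀ r F)
    (h : ∀ (M M' : FinStr.{u, v, w} L N) (α : ℕ → M) (α' : ℕ → M') (B : Fin 5 → Fin k → M)
      (B' : Fin 5 → Fin k → M'), F M α B = F M' α' B' → G M α B = G M' α' B') :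
    BlockDet K₀ r G :=
  Determined.imp hF fun _ _ _ _ => h _ _ _ _ _ _

theorem pi {ι : Type*} [Finite ι] {Z : ι → Type*}
    {F : ∀ i (M : FinStr.{u, v, w} L N), (ℕ → M) → (Fin 5 → Fin k → M) → Z i}
    (h : ∀ i, BlockDet K₀ r (F i)) : BlockDet K₀ r (fun M α B i => F i M α B) :=
  Determined.pi h

theorem prod (hF : BlockDet K₀ r F) (hG : BlockDet K₀ r G) :
    BlockDet K₀ r (fun M α B => (F M α B, G M α B)) :=
  Determined.prod hF hG

/-- Blocks can be permuted or duplicated at no cost in depth or variables; this is what lets the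
rounds of a recursion reuse the same blocks. -/
theorem subst (h0 : 0 < K₀) (hF : BlockDet K₀ r F) (f : Fin 5 → Fin 5) :
    BlockDet K₀ r (fun M α B => F M α (fun j => B (f j))) := by
  have := Determined.subst hF (Function.extend (blockVar K₀ k)
    (fun p => blockVar K₀ k (f p.1, p.2)) (baseVar K₀)) (fun i _ => by
      by_cases hi : ∃ p, blockVar K₀ k p = i
      · obtain ⟨p, rfl⟩ := hi
        rw [(blockVar_injective K₀ k).extend_apply]
        exact blockVar_lt _ _ _
      · rw [Function.extend_apply' _ _ _ hi]
        have := baseVar_lt h0 i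
        omega)
  refine this.imp fun M M' α α' h => ?_
  have key : ∀ (M : FinStr.{u, v, w} L N) (γ : ℕ → M),
      F M ((γ ∘ Function.extend (blockVar K₀ k) (fun p => blockVar K₀ k (f p.1, p.2))
        (baseVar K₀)) ∘ baseVar K₀) (fun j i => (γ ∘ Function.extend (blockVar K₀ k)
        (fun p => blockVar K₀ k (f p.1, p.2)) (baseVar K₀)) (blockVar K₀ k (j, i))) =
      F M (γ ∘ baseVar K₀) (fun j i => γ (blockVar K₀ k (f j, i))) := by
    intro M γ
    congr 1
    · funext i
      simp only [Function.comp_apply]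
      rw [Function.extend_apply' _ _ _ (fun ⟨p, hp⟩ => blockVar_ne_baseVar h0 p i hp),
        baseVar_baseVar h0]
    · funext j i
      simp only [Function.comp_apply, (blockVar_injective K₀ k).extend_apply]
  beta_reduce
  rw [← key M α, ← key M' α']
  exact h

/-- Back and forth over the values of a block. -/
theorem exists_bij (h0 : 0 < K₀) (hF : BlockDet K₀ r F) (j : Fin 5)
    (h : ∀ (M M' : FinStr.{u, v, w} L N) (α : ℕ → M) (α' : ℕ → M') (B : Fin 5 → Fin k → M)
      (B' : Fin 5 → Fin k → M') (f : (Fin k → M) ≃ (Fin k → M')),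
      (∀ s, F M' α' (Function.update B' j (f s)) = F M α (Function.update B j s)) →
        G M α B = G M' α' B') : BlockDet K₀ (r + k) G := by
  have hinj : Function.Injective fun i : Fin k => blockVar K₀ k (j, i) := fun a b hab =>
    (Prod.ext_iff.1 (blockVar_injective K₀ k hab)).2
  refine Determined.exists_bij_tuple (by omega) (fun i => blockVar K₀ k (j, i)) hinj
    (fun i => blockVar_lt _ _ _) hF fun M M' γ γ' f hf => h _ _ _ _ _ _ f fun s => ?_
  have key : ∀ (M : FinStr.{u, v, w} L N) (γ : ℕ → M) (s : Fin k → M),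
      F M (Function.extend (fun i => blockVar K₀ k (j, i)) s γ ∘ baseVar K₀)
        (fun j' i' => Function.extend (fun i => blockVar K₀ k (j, i)) s γ (blockVar K₀ k (j', i'))) =
      F M (γ ∘ baseVar K₀)
        (Function.update (fun j i => γ (blockVar K₀ k (j, i))) j s) := by
    intro M γ s
    congr 1
    · funext i
      exact Function.extend_apply' _ _ _ (fun ⟨p, hp⟩ => blockVar_ne_baseVar h0 _ i hp)
    · funext j' i'
      by_cases hj : j' = j
      · subst hj
        rw [hinj.extend_apply, Function.update_self]
      · rw [Function.update_of_ne hj]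
        exact Function.extend_apply' _ _ _ (fun ⟨p, hp⟩ =>
          hj (Prod.ext_iff.1 (blockVar_injective K₀ k hp)).1.symm)
  rw [← key, ← key]
  exact hf s

theorem exists_block (h0 : 0 < K₀)
    {F : ∀ M : FinStr.{u, v, w} L N, (ℕ → M) → (Fin 5 → Fin k → M) → Prop}
    (hF : BlockDet K₀ r F) (j : Fin 5) :
    BlockDet K₀ (r + k) (fun M α B => ∃ s, F M α (Function.update B j s)) :=
  hF.exists_bij h0 j fun M M' α α' B B' f hf => by
    simp only [← hf, eq_iff_iff]
    exact (f.exists_congr_left (p := fun s => F M' α' (Function.update B' j (f s)))).trans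
      (by simp)

theorem eq_blocks (j j' : Fin 5) :
    BlockDet K₀ r (fun (M : FinStr.{u, v, w} L N) _ (B : Fin 5 → Fin k → M) => B j = B j') := by
  have : ∀ i : Fin k, BlockDet K₀ r (fun (M : FinStr.{u, v, w} L N) _ (B : Fin 5 → Fin k → M) =>
      B j i = B j' i) := fun i =>
    Determined.of_sat (.eq (blockVar K₀ k (j, i)) (blockVar K₀ k (j', i)))
      ⟨by
        intro z hz
        simp only [CFormula.vars, Finset.mem_insert, Finset.mem_singleton] at hz
        rcases hz with rfl | rfl <;> exact Finset.mem_range.2 (blockVar_lt _ _ _), Nat.zero_le _⟩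
  refine (BlockDet.pi this).imp fun M M' α α' B B' h => ?_
  simp only [funext_iff] at h ⊢
  simp only [h]

/-- Substituting the first two blocks for tuples of variables. -/
theorem of_determined (h0 : 0 < K₀) {F : ∀ M : FinStr.{u, v, w} L N, (ℕ → M) → X}
    (hF : Determined K₀ r F) (y₁ y₂ : Fin k → ℕ) (hy₁ : Function.Injective y₁)
    (hy₂ : Function.Injective y₂) :
    BlockDet K₀ r (fun M α B => F M (Function.extend y₂ (B 1) (Function.extend y₁ (B 0) α))) := by
  refine ((hF.mono (Nat.le_add_right K₀ (5 * k)) le_rfl).subst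
    (Function.extend y₂ (fun i => blockVar K₀ k (1, i))
      (Function.extend y₁ (fun i => blockVar K₀ k (0, i)) (baseVar K₀))) ?_).imp ?_
  · intro z _
    by_cases h2 : ∃ i, y₂ i = z
    · obtain ⟨i, rfl⟩ := h2
      rw [hy₂.extend_apply]
      exact blockVar_lt _ _ _
    rw [Function.extend_apply' _ _ _ h2]
    by_cases h1 : ∃ i, y₁ i = z
    · obtain ⟨i, rfl⟩ := h1
      rw [hy₁.extend_apply]
      exact blockVar_lt _ _ _
    rw [Function.extend_apply' _ _ _ h1]
    exact (baseVar_lt h0 z).trans_le (Nat.le_add_right _ _)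
  · intro M M' γ γ' h
    have key : ∀ (M : FinStr.{u, v, w} L N) (γ : ℕ → M),
        γ ∘ Function.extend y₂ (fun i => blockVar K₀ k (1, i))
          (Function.extend y₁ (fun i => blockVar K₀ k (0, i)) (baseVar K₀)) =
        Function.extend y₂ (fun i => γ (blockVar K₀ k (1, i)))
          (Function.extend y₁ (fun i => γ (blockVar K₀ k (0, i))) (γ ∘ baseVar K₀)) := by
      intro M γ
      funext z
      rw [Function.comp_apply, Function.apply_extend γ]
      congr 1
      funext z
      rw [Function.comp_apply, Function.apply_extend γ]
      rfl
    beta_reduce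
    rw [← key M γ, ← key M' γ']
    exact h

/-! ### Limited recursion on the classes of a determined equivalence relation -/

/-- Each doubling quantifies the midpoint in block `2`, at a cost of `k`. -/
theorem squarePath {R : ∀ M : FinStr.{u, v, w} L N, (ℕ → M) → (Fin k → M) → (Fin k → M) → Prop}
    (h0 : 0 < K₀) (hR : BlockDet K₀ r (fun M α B => R M α (B 0) (B 1))) (j : ℕ) :
    BlockDet K₀ (r + k * j) (fun M α B => squarePath (R M α) j (B 0) (B 1)) := by
  induction j with
  | zero =>
    refine ((eq_blocks (r := r + k * 0) 0 1).prod (hR.prod (hR.subst h0 ![1, 0, 2, 3, 4]))).imp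
      fun M M' α α' B B' h => ?_
    simp only [Prod.mk.injEq] at h
    obtain ⟨h1, h2, h3⟩ := h
    change _ = _ at h3
    simp only [Matrix.cons_val_zero, Matrix.cons_val_one] at h3
    simp only [_root_.squarePath, h1, h2, h3]
  | succ j ih =>
    have h1 := ih.subst h0 ![0, 2, 2, 3, 4]
    have h2 := ih.subst h0 ![2, 1, 2, 3, 4]
    have h3 := ((h1.prod h2).imp (G := fun M α B => _root_.squarePath (R M α) j (B 0) (B 2) ∧
      _root_.squarePath (R M α) j (B 2) (B 1)) (by
        intro M M' α α' B B' h
        simp only [Prod.mk.injEq] at h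
        exact congrArg₂ And h.1 h.2)).exists_block h0 2
    refine (h3.mono (by rw [mul_add]; omega)).imp fun M M' α α' B B' h => ?_
    exact h

section Classes

variable {S : ∀ M : FinStr.{u, v, w} L N, (ℕ → M) → Setoid (Fin k → M)}
  {E : ∀ (M : FinStr.{u, v, w} L N) (α : ℕ → M), Quotient (S M α) → Quotient (S M α) → Prop}
  {C : ∀ (M : FinStr.{u, v, w} L N) (α : ℕ → M), Quotient (S M α) → Set ℕ}

theorem classSize (h0 : 0 < K₀) (hS : BlockDet K₀ r (fun M α B => S M α (B 0) (B 1))) :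
    BlockDet K₀ (r + k) (fun M α B => {s | S M α s (B 0)}.ncard) := by
  refine (hS.subst h0 ![1, 0, 2, 3, 4]).exists_bij h0 1 fun M M' α α' B B' f hf => ?_
  refine Nat.card_congr (f.subtypeEquiv fun s => ?_)
  exact (Iff.of_eq (hf s)).symm

/-- In-neighbours are classes, so their number needs class sizes (depth `k`) before the elements are
counted (another `k`). -/
theorem inDeg (h0 : 0 < K₀) (hS : BlockDet K₀ r (fun M α B => S M α (B 0) (B 1)))
    (hE : BlockDet K₀ r (fun M α B => E M α (Quotient.mk _ (B 0)) (Quotient.mk _ (B 1)))) :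
    BlockDet K₀ (r + 2 * k) (fun M α B => inDeg (E M α) (Quotient.mk _ (B 0))) := by
  refine (((hE.mono (Nat.le_add_right r k)).subst h0 ![1, 0, 2, 3, 4]).prod
    ((classSize h0 hS).subst h0 ![1, 0, 2, 3, 4])).exists_bij h0 1 (fun M M' α α' B B' f hf => ?_)
    |>.mono (by omega)
  simp only [Prod.mk.injEq] at hf
  exact ncard_classes_eq _ _ f _ _ (fun s => Iff.of_eq (hf s).1) fun s => (hf s).2

/-- Certificates for limited recursion, with the optional hypothesis in block `0` and the
conclusion in block `1`. -/
theorem cert (h0 : 0 < K₀) (hS : BlockDet K₀ r (fun M α B => S M α (B 0) (B 1)))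
    (hE : BlockDet K₀ r (fun M α B => E M α (Quotient.mk _ (B 0)) (Quotient.mk _ (B 1))))
    (hC : BlockDet K₀ r (fun M α B => C M α (Quotient.mk _ (B 0)))) (m d : ℕ) :
    BlockDet K₀ (r + 2 * k + d * (2 * k))
      (fun M α B (h : Option (Fin m × Bool)) (i : Fin m) (v : Bool) =>
        Cert (E M α) (C M α) m d (h.map fun p => (Quotient.mk _ (B 0), (p.1 : ℕ), p.2))
          (Quotient.mk _ (B 1)) i v) := by
  induction d with
  | zero =>
    refine (hS.mono (by omega)).imp fun M M' α α' B B' h => ?_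
    have e : ((Quotient.mk (S M α) (B 0) = Quotient.mk (S M α) (B 1)) =
        (Quotient.mk (S M' α') (B' 0) = Quotient.mk (S M' α') (B' 1))) := by
      rw [Quotient.eq, Quotient.eq]; exact h
    funext o i v
    rcases o with _ | ⟨j, w⟩
    · simp [Cert]
    · simp only [Cert, Option.map_some, Option.some.injEq, Prod.mk.injEq, e]
  | succ d ih =>
    have hr : r ≤ r + 2 * k + d * (2 * k) := by rw [add_assoc]; exact Nat.le_add_right _ _
    have hr' : r + k ≤ r + 2 * k + d * (2 * k) := by
      have := Nat.zero_le (d * (2 * k)); omega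
    -- The check of the guess at the class in block `2`; block `3` runs over representatives of its
    -- children. Resources and Boolean values index the determined function and use no variables.
    have loc : BlockDet K₀ (r + 2 * k + d * (2 * k) + k)
        (fun M α B (h : Option (Fin m × Bool)) (j : Fin m) (w : Bool) =>
          (∀ c, E M α (Quotient.mk _ (B 2)) c → ∃ w', Cert (E M α) (C M α) m d
            (h.map fun p => (Quotient.mk _ (B 0), (p.1 : ℕ), p.2)) c
            ((j - 1) / _root_.inDeg (E M α) c) w') ∧
          (w = true ↔ {c | E M α (Quotient.mk _ (B 2)) c ∧ Cert (E M α) (C M α) m d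
            (h.map fun p => (Quotient.mk _ (B 0), (p.1 : ℕ), p.2)) c
            ((j - 1) / _root_.inDeg (E M α) c) true}.ncard ∈ C M α (Quotient.mk _ (B 2)))) := by
      refine ((ih.subst h0 ![0, 3, 2, 3, 4]).prod
        (((hE.mono hr).subst h0 ![2, 3, 2, 3, 4]).prod
        ((((inDeg h0 hS hE).mono (Nat.le_add_right _ _)).subst h0 ![3, 1, 2, 3, 4]).prod
        ((((classSize h0 hS).mono hr').subst h0 ![3, 1, 2, 3, 4]).prod
        ((hC.mono hr).subst h0 ![2, 1, 2, 3, 4]))))).exists_bij h0 3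
        fun M M' α α' B B' f hf => ?_
      simp only [Prod.mk.injEq] at hf
      have hcert : ∀ (s : Fin k → M) (h : Option (Fin m × Bool)) (i : ℕ), i < m → ∀ v,
          (Cert (E M α) (C M α) m d (h.map fun p => (Quotient.mk _ (B 0), (p.1 : ℕ), p.2))
            (Quotient.mk _ s) i v ↔
          Cert (E M' α') (C M' α') m d (h.map fun p => (Quotient.mk _ (B' 0), (p.1 : ℕ), p.2))
            (Quotient.mk _ (f s)) i v) := fun s h i hi v =>
        (Iff.of_eq (congrFun (congrFun (congrFun (hf s).1 h) ⟨i, hi⟩) v)).symm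
      have hedge : ∀ s : Fin k → M, E M α (Quotient.mk _ (B 2)) (Quotient.mk _ s) ↔
          E M' α' (Quotient.mk _ (B' 2)) (Quotient.mk _ (f s)) := fun s =>
        (Iff.of_eq (hf s).2.1).symm
      have hdeg : ∀ s : Fin k → M, _root_.inDeg (E M α) (Quotient.mk _ s) =
          _root_.inDeg (E M' α') (Quotient.mk _ (f s)) := fun s => (hf s).2.2.1.symm
      have hlab : C M α (Quotient.mk _ (B 2)) = C M' α' (Quotient.mk _ (B' 2)) :=
        (hf (Classical.arbitrary _)).2.2.2.2.symm
      funext h j w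
      -- Resources of children stay below `m`, so the family indexed by `Fin m` from the previous
      -- round suffices.
      have hj : ∀ n, ((j : ℕ) - 1) / n < m := fun n =>
        ((Nat.div_le_self _ _).trans (Nat.sub_le _ _)).trans_lt j.2
      refine congrArg₂ And (propext ?_) ?_
      · constructor
        · intro H c
          obtain ⟨t, rfl⟩ := Quotient.exists_rep c
          obtain ⟨s, rfl⟩ := f.surjective t
          rw [← hedge, ← hdeg]
          intro hc
          obtain ⟨w', hw'⟩ := H _ hc
          exact ⟨w', (hcert s h _ (hj _) w').1 hw'⟩
        · intro H c
          obtain ⟨s, rfl⟩ := Quotient.exists_rep c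
          rw [hedge, hdeg]
          intro hc
          obtain ⟨w', hw'⟩ := H _ hc
          exact ⟨w', (hcert s h _ (hj _) w').2 hw'⟩
      · rw [hlab]
        refine congrArg (fun n => (w = true ↔ n ∈ C M' α' (Quotient.mk _ (B' 2)))) ?_
        refine ncard_classes_eq _ _ f _ _ (fun s => ?_) fun s => (hf s).2.2.2.1
        rw [hedge, hdeg]
        exact and_congr_right fun _ => (hcert s h _ (hj _) true).symm
    -- Block `2` now runs over representatives of the guessed class `u`. In the second component it
    -- takes the place of the hypothesis block, since the conclusion is derived from the guess.
    have step := ((ih.mono (Nat.le_add_right _ k)).prod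
      (((ih.mono (Nat.le_add_right _ k)).subst h0 ![2, 1, 2, 3, 4]).prod loc)).exists_bij h0 2
      (G := fun M α B (h : Option (Fin m × Bool)) (i : Fin m) (v : Bool) =>
        Cert (E M α) (C M α) m (d + 1) (h.map fun p => (Quotient.mk _ (B 0), (p.1 : ℕ), p.2))
          (Quotient.mk _ (B 1)) i v) (fun M M' α α' B B' f hf => by
        simp only [Prod.mk.injEq] at hf
        funext h i v
        simp only [Cert]
        have e1 := (congrFun (congrFun (congrFun (hf (Classical.arbitrary _)).1 h) i) v).symm
        refine congrArg₂ Or e1 (propext ?_)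
        have e2 : ∀ (s : Fin k → M) (j : ℕ) (hj : j < m) (w : Bool),
            Cert (E M α) (C M α) m d (some (Quotient.mk _ s, j, w)) (Quotient.mk _ (B 1)) i v ↔
            Cert (E M' α') (C M' α') m d (some (Quotient.mk _ (f s), j, w))
              (Quotient.mk _ (B' 1)) i v := fun s j hj w =>
          (Iff.of_eq (congrFun (congrFun (congrFun (hf s).2.1 (some (⟨j, hj⟩, w))) i) v)).symm
        have e3 := fun (s : Fin k → M) (j : ℕ) (hj : j < m) (w : Bool) =>
          Iff.of_eq (congrFun (congrFun (congrFun (hf s).2.2 h) ⟨j, hj⟩) w)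
        constructor
        · rintro ⟨u, j, w, hj, hj0, H1, H2⟩
          obtain ⟨s, rfl⟩ := Quotient.exists_rep u
          exact ⟨Quotient.mk _ (f s), j, w, hj, hj0, (e2 s j hj w).1 H1, (e3 s j hj w).2 H2⟩
        · rintro ⟨u, j, w, hj, hj0, H1, H2⟩
          obtain ⟨t, rfl⟩ := Quotient.exists_rep u
          obtain ⟨s, rfl⟩ := f.surjective t
          exact ⟨Quotient.mk _ s, j, w, hj, hj0, (e2 s j hj w).2 H1, (e3 s j hj w).1 H2⟩)
    exact step.mono (by rw [add_mul, one_mul]; omega)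

theorem recX (h0 : 0 < K₀) (hS : BlockDet K₀ r (fun M α B => S M α (B 0) (B 1)))
    (hE : BlockDet K₀ r (fun M α B => E M α (Quotient.mk _ (B 0)) (Quotient.mk _ (B 1))))
    (hC : BlockDet K₀ r (fun M α B => C M α (Quotient.mk _ (B 0)))) {m d i : ℕ} (hi : i < m)
    (hd : N ^ k * m ^ 2 ≤ 2 ^ d) :
    BlockDet K₀ (r + 2 * k + 2 * d * (2 * k))
      (fun M α B => recX (E M α) (C M α) i (Quotient.mk _ (B 1))) := by
  refine (cert h0 hS hE hC m (2 * d)).imp fun M M' α α' B B' h => propext ?_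
  have hcard : ∀ (M : FinStr.{u, v, w} L N) (α : ℕ → M),
      Nat.card (Quotient (S M α)) * m ^ 2 ≤ 2 ^ d := by
    intro M α
    refine (Nat.mul_le_mul_right _ ?_).trans hd
    refine (Nat.card_le_card_of_surjective _ Quotient.mk_surjective).trans_eq ?_
    rw [Nat.card_fun, M.card_eq, Nat.card_fin]
  rw [recX_iff_cert _ _ hi (hcard M α), recX_iff_cert _ _ hi (hcard M' α')]
  exact Iff.of_eq (congrFun (congrFun (congrFun h none) ⟨i, hi⟩) true)

end Classes

/-- The `lrec` operator applied to determined relations. -/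
theorem lrecX {R R' : ∀ M : FinStr.{u, v, w} L N, (ℕ → M) → (Fin k → M) → (Fin k → M) → Prop}
    {D : ∀ M : FinStr.{u, v, w} L N, (ℕ → M) → (Fin k → M) → Set ℕ} (h0 : 0 < K₀)
    (hR : BlockDet K₀ r (fun M α B => R M α (B 0) (B 1)))
    (hR' : BlockDet K₀ r (fun M α B => R' M α (B 0) (B 1)))
    (hD : BlockDet K₀ r (fun M α B => D M α (B 0))) {e m d i : ℕ} (he : N ^ k ≤ 2 ^ e)
    (hi : i < m) (hd : N ^ k * m ^ 2 ≤ 2 ^ d) :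
    BlockDet K₀ (r + k * e + 2 * k + 2 * k + 2 * d * (2 * k))
      (fun M α B => lrecX (R M α) (R' M α) (D M α) i (B 1)) := by
  have hS : BlockDet K₀ (r + k * e)
      (fun M α B => Relation.EqvGen.setoid (R M α) (B 0) (B 1)) := by
    refine (squarePath h0 hR e).imp fun M M' α α' B B' h => ?_
    have hcard : ∀ M : FinStr.{u, v, w} L N, Nat.card (Fin k → M) ≤ 2 ^ e := fun M => by
      rwa [Nat.card_fun, M.card_eq, Nat.card_fin]
    rw [squarePath_iff _ (hcard M), squarePath_iff _ (hcard M')] at h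
    exact h
  have hE : BlockDet K₀ (r + k * e + 2 * k) (fun M α B =>
      ∃ s s', (Quotient.mk (Relation.EqvGen.setoid (R M α)) s) = Quotient.mk _ (B 0) ∧
        (Quotient.mk (Relation.EqvGen.setoid (R M α)) s') = Quotient.mk _ (B 1) ∧
          R' M α s s') := by
    -- Representatives of the two endpoints are quantified in blocks `2` and `3`.
    refine (((((hS.subst h0 ![2, 0, 2, 3, 4]).prod ((hS.subst h0 ![3, 1, 2, 3, 4]).prod
      ((hR'.mono (Nat.le_add_right r (k * e))).subst h0 ![2, 3, 2, 3, 4]))).imp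
      (G := fun M α B => Relation.EqvGen.setoid (R M α) (B 2) (B 0) ∧
        Relation.EqvGen.setoid (R M α) (B 3) (B 1) ∧ R' M α (B 2) (B 3))
      (fun M M' α α' B B' h => by
        simp only [Prod.mk.injEq] at h
        exact congrArg₂ And h.1 (congrArg₂ And h.2.1 h.2.2))).exists_block h0 3).exists_block
          h0 2).mono (by omega) |>.imp fun M M' α α' B B' h => ?_
    simp only [Quotient.eq]
    exact h
  have hC : BlockDet K₀ (r + k * e + 2 * k) (fun M α B =>
      {c | ∃ s, (Quotient.mk (Relation.EqvGen.setoid (R M α)) s) = Quotient.mk _ (B 0) ∧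
        c ∈ D M α s}) := by
    refine ((hS.subst h0 ![1, 0, 2, 3, 4]).prod
      ((hD.mono (Nat.le_add_right r (k * e))).subst h0 ![1, 0, 2, 3, 4])).exists_bij h0 1
      (fun M M' α α' B B' f hf => ?_) |>.mono (by omega)
    simp only [Prod.mk.injEq] at hf
    ext c
    simp only [Quotient.eq]
    have e1 : ∀ s, Relation.EqvGen.setoid (R M α) s (B 0) ↔
      Relation.EqvGen.setoid (R M' α') (f s) (B' 0) := fun s => (Iff.of_eq (hf s).1).symm
    have e2 : ∀ s, D M α s = D M' α' (f s) := fun s => (hf s).2.symm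
    constructor
    · rintro ⟨s, h1, h2⟩
      exact ⟨f s, (e1 s).1 h1, e2 s ▸ h2⟩
    · rintro ⟨t, h1, h2⟩
      obtain ⟨s, rfl⟩ := f.surjective t
      exact ⟨s, (e1 s).2 h1, e2 s ▸ h2⟩
  exact recX h0 (hS.mono (Nat.le_add_right _ _)) hE hC hi hd

end BlockDet

/-! ### Translation of `LREC₌` -/

theorem extend_congr_of_mem {A : Type*} {k : ℕ} {y : Fin k → ℕ} (hy : Function.Injective y)
    (s : Fin k → A) {α α' : ℕ → A} {z : ℕ} (h : z ∉ Finset.univ.image y → α z = α' z) :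
    Function.extend y s α z = Function.extend y s α' z := by
  by_cases hz : ∃ i, y i = z
  · obtain ⟨i, rfl⟩ := hz
    rw [hy.extend_apply, hy.extend_apply]
  · rw [Function.extend_apply' _ _ _ hz, Function.extend_apply' _ _ _ hz]
    exact h (by simpa using hz)

theorem update_congr_of_sdiff {A : Type*} {x : ℕ} {s : Finset ℕ} {α α' : ℕ → A}
    (h : ∀ i ∈ s \ {x}, α i = α' i) (a : A) :
    ∀ i ∈ s, Function.update α x a i = Function.update α' x a i := by
  intro i hi
  by_cases hx : i = x
  · simp [hx]
  · simp only [Function.update_of_ne hx]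
    exact h i (by simp [hi, hx])

/-- Truth of a formula depends only on its free variables. -/
theorem LRecFormula.sat_congr {A : Type w} [L.Structure A] (φ : LRecFormula L) {α α' : ℕ → A}
    {β β' : ℕ → NumDom A} (hα : ∀ i ∈ φ.freeDom, α i = α' i) (hβ : ∀ i ∈ φ.freeNum, β i = β' i) :
    φ.Sat α β ↔ φ.Sat α' β' := by
  induction φ generalizing α α' β β' with
  | rel R x =>
    have : (fun j => α (x j)) = fun j => α' (x j) := by
      funext j; exact hα _ (by simp [LRecFormula.freeDom])
    simp [LRecFormula.Sat, this]
  | eqDom x y =>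
    simp [LRecFormula.Sat, hα x (by simp [LRecFormula.freeDom]),
      hα y (by simp [LRecFormula.freeDom])]
  | eqNum x y =>
    simp [LRecFormula.Sat, hβ x (by simp [LRecFormula.freeNum]),
      hβ y (by simp [LRecFormula.freeNum])]
  | le x y =>
    simp [LRecFormula.Sat, hβ x (by simp [LRecFormula.freeNum]),
      hβ y (by simp [LRecFormula.freeNum])]
  | succ x y =>
    simp [LRecFormula.Sat, hβ x (by simp [LRecFormula.freeNum]),
      hβ y (by simp [LRecFormula.freeNum])]
  | isMin x => simp [LRecFormula.Sat, hβ x (by simp [LRecFormula.freeNum])]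
  | isMax x => simp [LRecFormula.Sat, hβ x (by simp [LRecFormula.freeNum])]
  | neg φ ih => exact not_congr (ih hα hβ)
  | or φ₁ φ₂ ih₁ ih₂ =>
    simp only [LRecFormula.freeDom, LRecFormula.freeNum, Finset.mem_union] at hα hβ
    exact or_congr (ih₁ (fun i hi => hα i (.inl hi)) fun i hi => hβ i (.inl hi))
      (ih₂ (fun i hi => hα i (.inr hi)) fun i hi => hβ i (.inr hi))
  | exDom x φ ih => exact exists_congr fun a => ih (update_congr_of_sdiff hα a) hβ
  | exNum x φ ih => exact exists_congr fun a => ih hα (update_congr_of_sdiff hβ a)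
  | countDom x φ κ ih =>
    simp only [LRecFormula.freeNum, Finset.mem_union] at hβ
    have h1 := fun a => ih (update_congr_of_sdiff hα a) fun i hi => hβ i (.inl hi)
    simp only [LRecFormula.Sat, h1, hβ κ (by simp)]
  | countNum x φ κ ih =>
    simp only [LRecFormula.freeNum, Finset.mem_union] at hβ
    have h1 := fun a => ih hα (update_congr_of_sdiff (fun i hi => hβ i (.inl hi)) a)
    simp only [LRecFormula.Sat, h1, hβ κ (by simp)]
  | lrec y₁ y₂ ι φeq φE φC x κ hy hι hp hq ihe ihE ihC =>
    simp only [LRecFormula.freeDom, LRecFormula.freeNum, Finset.mem_union] at hα hβ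
    have hy₁ : Function.Injective y₁ := hy.comp Sum.inl_injective
    have hy₂ : Function.Injective y₂ := hy.comp Sum.inr_injective
    have e1 := fun s s' => ihe
      (α := Function.extend y₂ s' (Function.extend y₁ s α))
      (α' := Function.extend y₂ s' (Function.extend y₁ s α'))
      (fun i hi => extend_congr_of_mem hy₂ _ fun h2 => extend_congr_of_mem hy₁ _ fun h1 =>
        hα i (.inl (.inl (.inl (by
          simp only [Finset.mem_sdiff, Finset.mem_union, not_or]; exact ⟨hi, h1, h2⟩)))))
      fun i hi => hβ i (.inl (.inl (.inl hi)))
    have e2 := fun s s' => ihE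
      (α := Function.extend y₂ s' (Function.extend y₁ s α))
      (α' := Function.extend y₂ s' (Function.extend y₁ s α'))
      (fun i hi => extend_congr_of_mem hy₂ _ fun h2 => extend_congr_of_mem hy₁ _ fun h1 =>
        hα i (.inl (.inl (.inr (by
          simp only [Finset.mem_sdiff, Finset.mem_union, not_or]; exact ⟨hi, h1, h2⟩)))))
      fun i hi => hβ i (.inl (.inl (.inr hi)))
    have e3 := fun s t => ihC (α := Function.extend y₁ s α) (α' := Function.extend y₁ s α')
      (β := Function.extend ι t β) (β' := Function.extend ι t β')
      (fun i hi => extend_congr_of_mem hy₁ _ fun h1 =>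
        hα i (.inl (.inr (by simp only [Finset.mem_sdiff]; exact ⟨hi, h1⟩))))
      fun i hi => extend_congr_of_mem hι _ fun h1 =>
        hβ i (.inl (.inr (by simp only [Finset.mem_sdiff]; exact ⟨hi, h1⟩)))
    have e4 : (fun j => α (x j)) = fun j => α' (x j) := by
      funext j; exact hα _ (.inr (by simp))
    have e5 : (fun j => β (κ j)) = fun j => β' (κ j) := by
      funext j; exact hβ _ (.inr (by simp))
    simp only [LRecFormula.Sat, e1, e2, e3, e4, e5]

/-! ### Number variables as external parameters -/

/-- The assignment of numbers in `N(A)` given by natural numbers. -/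
noncomputable def numAsg (A : Type w) (b : ℕ → ℕ) (i : ℕ) : NumDom A :=
  Fin.ofNat (Nat.card A + 1) (b i)

theorem coe_numAsg (M : FinStr.{u, v, w} L N) (b : ℕ → ℕ) (i : ℕ) :
    (numAsg M b i : ℕ) = b i % (N + 1) := by
  simp [numAsg, M.card_eq]

/-- Binding a number variable only changes the parameter `b`, so number quantifiers and counts are
handled by finitely many instances of the induction hypothesis. -/
theorem update_numAsg (A : Type w) (b : ℕ → ℕ) (x : ℕ) (i : NumDom A) :
    Function.update (numAsg A b) x i = numAsg A (Function.update b x i) := by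
  funext z
  by_cases hz : z = x
  · simp [hz, numAsg]
  · simp [hz, numAsg]

theorem extend_numAsg (A : Type w) (b : ℕ → ℕ) {p : ℕ} (ι : Fin p → ℕ) (i : Fin p → NumDom A) :
    Function.extend ι i (numAsg A b) =
      numAsg A (Function.extend ι (fun j => (i j : ℕ)) b) := by
  funext z
  simp only [numAsg, Function.extend]
  split_ifs <;> simp

/-- Numbers of structures of the same size. -/
noncomputable def FinStr.numEquiv (M M' : FinStr.{u, v, w} L N) : NumDom M ≃ NumDom M' :=
  finCongr (by rw [M.card_eq, M'.card_eq])

theorem numVal_lt (M : FinStr.{u, v, w} L N) {q : ℕ} (i : Fin q → NumDom M) :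
    numVal i < (N + 1) ^ q := by
  have := (finFunctionFinEquiv i).2
  rw [finFunctionFinEquiv_apply] at this
  exact this.trans_eq (by rw [M.card_eq])

/-- A bound for binary length. -/
def logLen (N : ℕ) : ℕ := Nat.log 2 N + 1

theorem succ_le_two_pow_logLen (N : ℕ) : N + 1 ≤ 2 ^ logLen N :=
  Nat.lt_pow_succ_log_self (by norm_num) N

/-- The summands of the depth: squaring over `k`-tuples, edges and labels of classes (`2 * k`),
in-degrees (`2 * k`), and `2 * d` rounds of `2 * k` each. Here `d = logLen N * (k + 2 * q)`
satisfies `N ^ k * m ^ 2 ≤ 2 ^ d` for the resource bound `m = (N + 1) ^ q`. -/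
theorem Determined.lrec {k p q K₀ r : ℕ} {y₁ y₂ : Fin k → ℕ} {ι : Fin p → ℕ}
    {φeq φE φC : LRecFormula L} {x : Fin k → ℕ} {κ : Fin q → ℕ}
    (hy : Function.Injective (Sum.elim y₁ y₂)) (hι : Function.Injective ι) (hp : 0 < p)
    (hq : 0 < q) (h0 : 0 < K₀) (hxK : ∀ j, x j < K₀) (hyeq : ∀ i ∈ φeq.freeDom, i < K₀)
    (hyE : ∀ i ∈ φE.freeDom, i < K₀) (hyC : ∀ i ∈ φC.freeDom, i < K₀)
    (heq : ∀ b, Determined K₀ r (fun (M : FinStr.{u, v, w} L N) α => φeq.Sat α (numAsg M b)))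
    (hE : ∀ b, Determined K₀ r (fun (M : FinStr.{u, v, w} L N) α => φE.Sat α (numAsg M b)))
    (hC : ∀ b, Determined K₀ r (fun (M : FinStr.{u, v, w} L N) α => φC.Sat α (numAsg M b)))
    (b : ℕ → ℕ) :
    Determined (K₀ + 5 * k)
      (r + k * (logLen N * k) + 2 * k + 2 * k + 2 * (logLen N * (k + 2 * q)) * (2 * k))
      (fun (M : FinStr.{u, v, w} L N) α =>
        (LRecFormula.lrec y₁ y₂ ι φeq φE φC x κ hy hι hp hq).Sat α (numAsg M b)) := by
  have hy₁ : Function.Injective y₁ := hy.comp Sum.inl_injective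
  have hy₂ : Function.Injective y₂ := hy.comp Sum.inr_injective
  have hN := succ_le_two_pow_logLen N
  set v : ℕ := ∑ j : Fin q, (b (κ j) % (N + 1)) * (N + 1) ^ (j : ℕ) with hv
  have hval : ∀ M : FinStr.{u, v, w} L N, numVal (fun j => numAsg M b (κ j)) = v := by
    intro M
    simp only [numVal, coe_numAsg, M.card_eq, hv]
  by_cases hM : Nonempty (FinStr.{u, v, w} L N)
  swap
  · exact Determined.of_const fun M => absurd ⟨M⟩ hM
  have hlab : BlockDet K₀ r (fun (M : FinStr.{u, v, w} L N) α (B : Fin 5 → Fin k → M) =>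
      {c | ∃ i : Fin p → NumDom M, φC.Sat (Function.extend y₁ (B 0) α)
        (Function.extend ι i (numAsg M b)) ∧ numVal i = c}) := by
    have h1 : BlockDet K₀ r (fun (M : FinStr.{u, v, w} L N) α (B : Fin 5 → Fin k → M)
        (i : Fin p → Fin (N + 1)) => φC.Sat (Function.extend y₁ (B 0) α)
          (numAsg M (Function.extend ι (fun j => (i j : ℕ)) b))) :=
      -- The label formula takes one tuple only: `y₁` is substituted twice, with the same block.
      BlockDet.pi fun i => ((BlockDet.of_determined h0 (hC _) y₁ y₁ hy₁ hy₁).subst h0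
        ![0, 0, 0, 0, 0]).imp fun M M' α α' B B' h => by
          have key : ∀ (M : FinStr.{u, v, w} L N) (α : ℕ → M) (s : Fin k → M),
              Function.extend y₁ s (Function.extend y₁ s α) = Function.extend y₁ s α := by
            intro M α s
            funext z
            by_cases hz : ∃ i, y₁ i = z
            · obtain ⟨i, rfl⟩ := hz
              rw [hy₁.extend_apply, hy₁.extend_apply]
            · rw [Function.extend_apply' _ _ _ hz]
          simp only [Matrix.cons_val_zero, Matrix.cons_val_one, key] at h
          exact h
    refine h1.imp fun M M' α α' B B' h => ?_
    have key : ∀ (M : FinStr.{u, v, w} L N) (α : ℕ → M) (B : Fin 5 → Fin k → M) (c : ℕ),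
        (∃ i : Fin p → NumDom M, φC.Sat (Function.extend y₁ (B 0) α)
          (Function.extend ι i (numAsg M b)) ∧ numVal i = c) ↔
        ∃ i : Fin p → Fin (N + 1), φC.Sat (Function.extend y₁ (B 0) α)
          (numAsg M (Function.extend ι (fun j => (i j : ℕ)) b)) ∧
          ∑ j, (i j : ℕ) * (N + 1) ^ (j : ℕ) = c := by
      intro M α B c
      have e : Nat.card M + 1 = N + 1 := by rw [M.card_eq]
      constructor
      · rintro ⟨i, h1, h2⟩
        refine ⟨fun j => (i j).cast e, ?_, ?_⟩
        · rw [extend_numAsg] at h1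
          exact h1
        · simpa [numVal, M.card_eq] using h2
      · rintro ⟨i, h1, h2⟩
        refine ⟨fun j => (i j).cast e.symm, ?_, ?_⟩
        · rw [extend_numAsg]
          exact h1
        · simpa [numVal, M.card_eq] using h2
    ext c
    rw [Set.mem_ofPred_eq, Set.mem_ofPred_eq, key, key]
    exact exists_congr fun i => and_congr_left fun _ => Iff.of_eq (congrFun h i)
  have main := BlockDet.lrecX (e := logLen N * k) (m := (N + 1) ^ q)
    (d := logLen N * (k + 2 * q)) (i := v)
    (R := fun (M : FinStr.{u, v, w} L N) α (s s' : Fin k → M) =>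
      φeq.Sat (Function.extend y₂ s' (Function.extend y₁ s α)) (numAsg M b))
    (R' := fun (M : FinStr.{u, v, w} L N) α (s s' : Fin k → M) =>
      φE.Sat (Function.extend y₂ s' (Function.extend y₁ s α)) (numAsg M b))
    (D := fun (M : FinStr.{u, v, w} L N) α (s : Fin k → M) =>
      {c | ∃ i : Fin p → NumDom M, φC.Sat (Function.extend y₁ s α)
        (Function.extend ι i (numAsg M b)) ∧ numVal i = c}) h0
    (BlockDet.of_determined h0 (heq b) y₁ y₂ hy₁ hy₂)
    (BlockDet.of_determined h0 (hE b) y₁ y₂ hy₁ hy₂) hlab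
    (by rw [pow_mul]; exact Nat.pow_le_pow_left (by omega) _)
    (by obtain ⟨M⟩ := hM; rw [← hval M]; exact numVal_lt M _)
    (by
      rw [← pow_mul, mul_comm q 2, pow_mul 2 (logLen N), pow_add]
      exact Nat.mul_le_mul (Nat.pow_le_pow_left (by omega) _) (Nat.pow_le_pow_left hN _))
  have hinj : Function.Injective fun i : Fin k => blockVar K₀ k (1, i) := fun a b hab =>
    (Prod.ext_iff.1 (blockVar_injective K₀ k hab)).2
  -- Block `1`, holding the tuple at which the operator is evaluated, is replaced by the variables
  -- `x`.
  refine (Determined.subst main (Function.extend (fun i => blockVar K₀ k (1, i)) x id)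
    fun z hz => ?_).imp fun M M' γ γ' h => ?_
  · by_cases h : ∃ i, blockVar K₀ k (1, i) = z
    · obtain ⟨i, rfl⟩ := h
      rw [hinj.extend_apply (a := i)]
      exact (hxK i).trans_le (Nat.le_add_right _ _)
    · rwa [Function.extend_apply' _ _ _ h]
  · have key : ∀ (M : FinStr.{u, v, w} L N) (γ : ℕ → M),
        (LRecFormula.lrec y₁ y₂ ι φeq φE φC x κ hy hι hp hq).Sat γ (numAsg M b) =
        lrecX
          (fun s s' => φeq.Sat (Function.extend y₂ s' (Function.extend y₁ s
            ((γ ∘ Function.extend (fun i => blockVar K₀ k (1, i)) x id) ∘ baseVar K₀)))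
            (numAsg M b))
          (fun s s' => φE.Sat (Function.extend y₂ s' (Function.extend y₁ s
            ((γ ∘ Function.extend (fun i => blockVar K₀ k (1, i)) x id) ∘ baseVar K₀)))
            (numAsg M b))
          (fun s => {c | ∃ i : Fin p → NumDom M, φC.Sat (Function.extend y₁ s
            ((γ ∘ Function.extend (fun i => blockVar K₀ k (1, i)) x id) ∘ baseVar K₀))
            (Function.extend ι i (numAsg M b)) ∧ numVal i = c}) v
          (fun i => (γ ∘ Function.extend (fun i => blockVar K₀ k (1, i)) x id)
            (blockVar K₀ k (1, i))) := by
      intro M γ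
      have hγ : (γ ∘ Function.extend (fun i => blockVar K₀ k (1, i)) x id) ∘ baseVar K₀ =
          γ ∘ baseVar K₀ := by
        funext z
        simp only [Function.comp_apply]
        rw [Function.extend_apply' _ _ _ (fun ⟨p, hp⟩ => blockVar_ne_baseVar h0 _ z hp)]
        rfl
      have hγ' : ∀ z < K₀, γ z = (γ ∘ baseVar K₀) z := fun z hz => by
        simp [baseVar, hz]
      have ht : (fun i => (γ ∘ Function.extend (fun i => blockVar K₀ k (1, i)) x id)
          (blockVar K₀ k (1, i))) = fun i => γ (x i) := by
        funext i
        simp only [Function.comp_apply]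
        rw [hinj.extend_apply (a := i)]
      have e1 : ∀ s s', φeq.Sat (Function.extend y₂ s' (Function.extend y₁ s γ)) (numAsg M b) ↔
          φeq.Sat (Function.extend y₂ s' (Function.extend y₁ s (γ ∘ baseVar K₀))) (numAsg M b) :=
        fun s s' => LRecFormula.sat_congr _ (fun z hz => extend_congr_of_mem hy₂ _ fun _ =>
          extend_congr_of_mem hy₁ _ fun _ => hγ' z (hyeq z hz)) fun _ _ => rfl
      have e2 : ∀ s s', φE.Sat (Function.extend y₂ s' (Function.extend y₁ s γ)) (numAsg M b) ↔
          φE.Sat (Function.extend y₂ s' (Function.extend y₁ s (γ ∘ baseVar K₀))) (numAsg M b) :=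
        fun s s' => LRecFormula.sat_congr _ (fun z hz => extend_congr_of_mem hy₂ _ fun _ =>
          extend_congr_of_mem hy₁ _ fun _ => hγ' z (hyE z hz)) fun _ _ => rfl
      have e3 : ∀ s t, φC.Sat (Function.extend y₁ s γ) t ↔
          φC.Sat (Function.extend y₁ s (γ ∘ baseVar K₀)) t :=
        fun s t => LRecFormula.sat_congr _ (fun z hz =>
          extend_congr_of_mem hy₁ _ fun _ => hγ' z (hyC z hz)) fun _ _ => rfl
      rw [hγ, ht]
      simp only [LRecFormula.Sat, e1, e2, e3, hval]
    rw [key M γ, key M' γ']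
    exact h

/-- Every `LREC₌`-formula is determined by formulae with boundedly many variables and logarithmic
quantifier depth. -/
theorem LRecFormula.exists_determined (φ : LRecFormula L) :
    ∃ K c : ℕ, 0 < K ∧ ∀ (N : ℕ) (b : ℕ → ℕ), Determined K (c * logLen N)
      (fun (M : FinStr.{u, v, w} L N) α => φ.Sat α (numAsg M b)) := by
  have hlog : ∀ N, 0 < logLen N := fun N => Nat.succ_pos _
  induction φ with
  | rel R x =>
    refine ⟨(Finset.univ.image x).sup id + 1, 0, Nat.succ_pos _, fun N b => ?_⟩
    refine Determined.of_sat (.rel R x) ⟨fun z hz => ?_, by simp [CFormula.qd]⟩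
    exact Finset.mem_range.2 (Nat.lt_succ_of_le (Finset.le_sup (f := id) hz))
  | eqDom x y =>
    refine ⟨max x y + 1, 0, Nat.succ_pos _, fun N b => ?_⟩
    refine Determined.of_sat (.eq x y) ⟨fun z hz => ?_, by simp [CFormula.qd]⟩
    simp only [CFormula.vars, Finset.mem_insert, Finset.mem_singleton] at hz
    exact Finset.mem_range.2 (by omega)
  | eqNum x y =>
    exact ⟨1, 0, one_pos, fun N b => Determined.of_const fun M M' α α' => by
      simp only [LRecFormula.Sat, Fin.ext_iff, coe_numAsg]⟩
  | le x y =>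
    exact ⟨1, 0, one_pos, fun N b => Determined.of_const fun M M' α α' => by
      simp only [LRecFormula.Sat, Fin.le_def, coe_numAsg]⟩
  | succ x y =>
    exact ⟨1, 0, one_pos, fun N b => Determined.of_const fun M M' α α' => by
      simp only [LRecFormula.Sat, coe_numAsg]⟩
  | isMin x =>
    exact ⟨1, 0, one_pos, fun N b => Determined.of_const fun M M' α α' => by
      simp only [LRecFormula.Sat, coe_numAsg]⟩
  | isMax x =>
    exact ⟨1, 0, one_pos, fun N b => Determined.of_const fun M M' α α' => by
      simp only [LRecFormula.Sat, coe_numAsg, M.card_eq, M'.card_eq]⟩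
  | neg φ ih =>
    obtain ⟨K, c, hK, h⟩ := ih
    exact ⟨K, c, hK, fun N b => (h N b).imp fun M M' α α' e => congrArg Not e⟩
  | or φ₁ φ₂ ih₁ ih₂ =>
    obtain ⟨K, c, hK, h⟩ := ih₁
    obtain ⟨K', c', hK', h'⟩ := ih₂
    refine ⟨max K K', max c c', by omega, fun N b => ?_⟩
    refine (((h N b).mono (le_max_left K K') (Nat.mul_le_mul_right _ (le_max_left c c'))).prod
      ((h' N b).mono (le_max_right K K') (Nat.mul_le_mul_right _ (le_max_right c c')))).imp
      fun M M' α α' e => ?_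
    simp only [Prod.mk.injEq] at e
    exact congrArg₂ Or e.1 e.2
  | exDom x φ ih =>
    obtain ⟨K, c, hK, h⟩ := ih
    refine ⟨max K (x + 1), c + 1, by omega, fun N b => ?_⟩
    refine (Determined.exists_bij_var (x := x) (by omega)
      ((h N b).mono (le_max_left K (x + 1)) le_rfl) (by omega)
      fun M M' α α' f hf => propext ?_).mono le_rfl
        (by rw [add_mul, one_mul]; exact Nat.add_le_add_left (hlog N) _)
    simp only [LRecFormula.Sat, ← hf]
    exact f.exists_congr_left.trans (by simp)
  | exNum x φ ih =>
    obtain ⟨K, c, hK, h⟩ := ih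
    refine ⟨K, c, hK, fun N b => ?_⟩
    -- All `N + 1` values of the bound number variable are treated in parallel, so neither variables
    -- nor depth grow.
    refine (Determined.pi fun i : Fin (N + 1) => h N (Function.update b x i)).imp
      fun M M' α α' e => propext ?_
    simp only [LRecFormula.Sat, update_numAsg]
    refine (M.numEquiv M').exists_congr fun i => Iff.of_eq ?_
    exact congrFun e (i.cast (by rw [M.card_eq]))
  | countDom x φ κ ih =>
    obtain ⟨K, c, hK, h⟩ := ih
    refine ⟨max K (x + 1), c + 1, by omega, fun N b => ?_⟩
    refine (Determined.exists_bij_var (x := x) (by omega)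
      ((h N b).mono (le_max_left K (x + 1)) le_rfl) (by omega)
      fun M M' α α' f hf => ?_).mono le_rfl
        (by rw [add_mul, one_mul]; exact Nat.add_le_add_left (hlog N) _)
    simp only [LRecFormula.Sat, coe_numAsg]
    refine congrArg (· = _) ?_
    exact Nat.card_congr (f.subtypeEquiv fun a => (Iff.of_eq (hf a)).symm)
  | countNum x φ κ ih =>
    obtain ⟨K, c, hK, h⟩ := ih
    refine ⟨K, c, hK, fun N b => ?_⟩
    refine (Determined.pi fun i : Fin (N + 1) => h N (Function.update b x i)).imp
      fun M M' α α' e => ?_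
    simp only [LRecFormula.Sat, update_numAsg, coe_numAsg]
    refine congrArg (· = _) ?_
    refine Nat.card_congr ((M.numEquiv M').subtypeEquiv fun i => Iff.of_eq ?_)
    exact congrFun e (i.cast (by rw [M.card_eq]))
  | @lrec k p q y₁ y₂ ι φeq φE φC x κ hy hι hp hq ihe ihE ihC =>
    obtain ⟨K₁, c₁, hK₁, h₁⟩ := ihe
    obtain ⟨K₂, c₂, hK₂, h₂⟩ := ihE
    obtain ⟨K₃, c₃, hK₃, h₃⟩ := ihC
    let vs : Finset ℕ := Finset.univ.image x ∪ φeq.freeDom ∪ φE.freeDom ∪ φC.freeDom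
    let K₀ := K₁ + K₂ + K₃ + (vs.sup id + 1)
    have hvs : ∀ i ∈ vs, i < K₀ := fun i hi => by
      have := Finset.le_sup (f := id) hi
      simp only [id] at this
      omega
    refine ⟨K₀ + 5 * k, c₁ + c₂ + c₃ + k * k + 4 * k + 2 * (k + 2 * q) * (2 * k), by omega,
      fun N b => ?_⟩
    refine (Determined.lrec (K₀ := K₀) (r := (c₁ + c₂ + c₃) * logLen N) hy hι hp hq (by omega)
      (fun j => hvs _ (by simp [vs])) (fun i hi => hvs _ (by simp [vs, hi]))
      (fun i hi => hvs _ (by simp [vs, hi])) (fun i hi => hvs _ (by simp [vs, hi]))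
      (fun b => (h₁ N b).mono (by omega) (Nat.mul_le_mul_right _ (by omega)))
      (fun b => (h₂ N b).mono (by omega) (Nat.mul_le_mul_right _ (by omega)))
      (fun b => (h₃ N b).mono (by omega) (Nat.mul_le_mul_right _ (by omega))) b).mono le_rfl ?_
    have : 4 * k ≤ 4 * k * logLen N := Nat.le_mul_of_pos_right _ (hlog N)
    calc _ = (c₁ + c₂ + c₃) * logLen N + k * k * logLen N + 4 * k +
          2 * (k + 2 * q) * (2 * k) * logLen N := by ring
      _ ≤ (c₁ + c₂ + c₃) * logLen N + k * k * logLen N + 4 * k * logLen N +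
          2 * (k + 2 * q) * (2 * k) * logLen N := by omega
      _ = _ := by ring

/-! ### Assembling formulae for all sizes up to `n` -/

/-- Existential quantification over the variables in a finite set. -/
theorem CFormula.exists_exs (ψ : CFormula L) {K r : ℕ} (hψ : ψ.InC K r) (s : Finset ℕ)
    (hs : s ⊆ Finset.range K) : ∃ χ : CFormula L, χ.InC K (r + s.card) ∧ χ.free ⊆ ψ.free \ s ∧
      ∀ (A : Type w) [L.Structure A] (α : ℕ → A),
        χ.Sat α ↔ ∃ α' : ℕ → A, (∀ i ∉ s, α' i = α i) ∧ ψ.Sat α' := by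
  induction s using Finset.induction_on with
  | empty =>
    refine ⟨ψ, hψ, by simp, fun A _ α => ⟨fun h => ⟨α, fun _ _ => rfl, h⟩, ?_⟩⟩
    rintro ⟨α', h1, h2⟩
    rwa [← funext fun i => h1 i (by simp)]
  | insert x s hx ih =>
    obtain ⟨χ, h1, h2, h3⟩ := ih fun i hi => hs (by simp [hi])
    refine ⟨.ex x χ, ⟨Finset.union_subset h1.1 (by simpa using hs (Finset.mem_insert_self x s)),
      ?_⟩, ?_, fun A _ α => ?_⟩
    · rw [Finset.card_insert_of_notMem hx]
      exact Nat.succ_le_succ h1.2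
    · intro i hi
      simp only [CFormula.free, Finset.mem_sdiff, Finset.mem_singleton] at hi
      have := h2 hi.1
      simp only [Finset.mem_sdiff, Finset.mem_insert] at this ⊢
      tauto
    · simp only [CFormula.Sat, h3]
      constructor
      · rintro ⟨a, α', h4, h5⟩
        refine ⟨α', fun i hi => ?_, h5⟩
        simp only [Finset.mem_insert, not_or] at hi
        rw [h4 i hi.2, Function.update_of_ne hi.1]
      · rintro ⟨α', h4, h5⟩
        refine ⟨α' x, α', fun i hi => ?_, h5⟩
        by_cases hix : i = x
        · simp [hix]
        · rw [Function.update_of_ne hix]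
          exact h4 i (by simp [hix, hi])

theorem CFormula.free_subset_vars (ψ : CFormula L) : ψ.free ⊆ ψ.vars := by
  induction ψ with
  | rel R x => exact le_rfl
  | eq x y => exact le_rfl
  | neg φ ih => exact ih
  | or φ₁ φ₂ ih₁ ih₂ => exact Finset.union_subset_union ih₁ ih₂
  | ex x φ ih => exact (Finset.sdiff_subset.trans ih).trans Finset.subset_union_left
  | exGe m x φ ih => exact (Finset.sdiff_subset.trans ih).trans Finset.subset_union_left

/-- Case distinction on the size of the structure. -/
theorem CFormula.exists_size_cases {K r : ℕ} (hK : 0 < K) (hr : 0 < r) (ψ : ℕ → CFormula L) (n : ℕ)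
    (hψ : ∀ N ≤ n, (ψ N).InC K r) : ∃ χ : CFormula L, χ.InC K r ∧
      ∀ (A : Type w) [L.Structure A] [Finite A], Nat.card A ≤ n →
        ∀ α : ℕ → A, χ.Sat α ↔ (ψ (Nat.card A)).Sat α := by
  induction n with
  | zero => exact ⟨ψ 0, hψ 0 le_rfl, fun A _ _ hA α => by rw [Nat.le_zero.1 hA]⟩
  | succ n ih =>
    obtain ⟨χ, h1, h2⟩ := ih fun N hN => hψ N (hN.trans (Nat.le_succ n))
    have hs := hψ (n + 1) le_rfl
    -- A single counting quantifier separates size `n + 1` from the smaller sizes; this is the depth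
    -- that `hr` provides.
    let big : CFormula L := .exGe (n + 1) 0 (.eq 0 0)
    have hbig : big.InC K r := ⟨by simp [big, CFormula.vars, hK], by simp [big, CFormula.qd]; omega⟩
    have hsat : ∀ (A : Type w) [L.Structure A] (α : ℕ → A), big.Sat α ↔ n + 1 ≤ Nat.card A := by
      intro A _ α
      simp [big, CFormula.Sat]
    refine ⟨.or (.neg (.or big (.neg χ))) (.neg (.or (.neg big) (.neg (ψ (n + 1))))),
      ⟨?_, ?_⟩, fun A _ _ hA α => ?_⟩
    · simp only [CFormula.vars]
      exact Finset.union_subset (Finset.union_subset hbig.1 h1.1)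
        (Finset.union_subset hbig.1 hs.1)
    · simp only [CFormula.qd]
      exact max_le (max_le hbig.2 h1.2) (max_le hbig.2 hs.2)
    · simp only [CFormula.Sat, hsat, not_or, not_not]
      rcases Nat.lt_or_ge n (Nat.card A) with h | h
      · have : Nat.card A = n + 1 := le_antisymm hA h
        rw [this]
        simp
      · rw [h2 A h α]
        simp [Nat.not_lt.2 h]

/-! ### The logarithmic bound and the final formulae -/

theorem isBigO_logLen (c d : ℕ) :
    (fun n : ℕ => ((c * logLen n + d : ℕ) : ℝ)) =O[Filter.atTop] fun n : ℕ => Real.log n := by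
  -- One summand each for `Nat.log 2 n`, for the `+ 1` in `logLen`, and for `d`; the last two use
  -- `log 2 ≤ log n` for `n ≥ 2`.
  refine Asymptotics.IsBigO.of_bound (c / Real.log 2 + c / Real.log 2 + d / Real.log 2) ?_
  filter_upwards [Filter.eventually_ge_atTop 2] with n hn
  have h2 : 0 < Real.log 2 := Real.log_pos (by norm_num)
  have hl : Real.log 2 ≤ Real.log n := Real.log_le_log (by norm_num) (by exact_mod_cast hn)
  have hlog : (Nat.log 2 n : ℝ) ≤ Real.log n / Real.log 2 := by
    rw [le_div_iff₀ h2, ← Real.log_pow]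
    refine Real.log_le_log (by positivity) ?_
    exact_mod_cast Nat.pow_log_le_self 2 (by omega)
  have h1 : 1 ≤ Real.log n / Real.log 2 := by rwa [le_div_iff₀ h2, one_mul]
  rw [Real.norm_of_nonneg (by positivity), Real.norm_of_nonneg (h2.le.trans hl)]
  push_cast [logLen]
  have e : (c / Real.log 2 + c / Real.log 2 + d / Real.log 2) * Real.log n =
      c * (Real.log n / Real.log 2 + Real.log n / Real.log 2) +
        d * (Real.log n / Real.log 2) := by ring
  rw [e]
  exact add_le_add (mul_le_mul_of_nonneg_left (add_le_add hlog h1) (by positivity))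
    (le_mul_of_one_le_right (by positivity) h1)

theorem theorem1 (L : FirstOrder.Language.{u, v}) [L.IsRelational] (φ : LRecFormula L)
    {p q : ℕ} (x : Fin p → ℕ) (κ : Fin q → ℕ)
    (hx : Function.Injective x) (hκ : Function.Injective κ)
    (hφx : (φ.freeDom : Set ℕ) ⊆ Set.range x) (hφκ : (φ.freeNum : Set ℕ) ⊆ Set.range κ) :
    ∃ (k : ℕ) (f : ℕ → ℕ),
      ((fun n : ℕ => (f n : ℝ)) =O[Filter.atTop] fun n : ℕ => Real.log n) ∧
      ∀ n : ℕ, ∃ ψ : (Fin q → Set.Icc 1 n) → CFormula L,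
        (∀ m, (ψ m).InC k (f n) ∧ ((ψ m).free : Set ℕ) ⊆ Set.range x) ∧
        ∀ (A : Type w) [L.Structure A] [Finite A] [Nonempty A], Nat.card A ≤ n →
          ∀ (a : Fin p → A) (m : Fin q → Set.Icc 1 n), (∀ j, (m j : ℕ) ≤ Nat.card A) →
            ∀ (α : ℕ → A) (β : ℕ → NumDom A),
              (∀ j, α (x j) = a j) → (∀ j, (β (κ j) : ℕ) = m j) →
              (φ.Sat α β ↔ (ψ m).Sat α) := by
  obtain ⟨K, c, hK, hdet⟩ := LRecFormula.exists_determined.{u, v, w} φ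
  let s : Finset ℕ := Finset.range K \ Finset.univ.image x
  -- Beyond the translation, `1` pays for the size test and `s.card` for quantifying away the
  -- variables outside `x`.
  refine ⟨K, fun n => c * logLen n + (1 + s.card), isBigO_logLen c _, fun n => ?_⟩
  have main : ∀ m : Fin q → Set.Icc 1 n, ∃ ψ : CFormula L,
      (ψ.InC K (c * logLen n + (1 + s.card)) ∧ (ψ.free : Set ℕ) ⊆ Set.range x) ∧
      ∀ (A : Type w) [L.Structure A] [Finite A] [Nonempty A], Nat.card A ≤ n →
        (∀ j, (m j : ℕ) ≤ Nat.card A) → ∀ (α : ℕ → A) (β : ℕ → NumDom A),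
          (∀ j, (β (κ j) : ℕ) = m j) → (φ.Sat α β ↔ ψ.Sat α) := by
    intro m
    let b : ℕ → ℕ := Function.extend κ (fun j => (m j : ℕ)) 0
    choose χ hχ hχs using fun N => (hdet N b).exists_formula hK
    have hmono : ∀ N ≤ n, (χ N).InC K (c * logLen n + 1) := fun N hN =>
      (hχ N).mono le_rfl ((Nat.mul_le_mul_left c
        (Nat.add_le_add_right (Nat.log_mono_right hN) 1)).trans (Nat.le_succ _))
    obtain ⟨θ, hθ, hθs⟩ := CFormula.exists_size_cases.{u, v, w} hK (Nat.succ_pos _) χ n hmono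
    obtain ⟨ψ, hψ, hψf, hψs⟩ := CFormula.exists_exs.{u, v, w} θ hθ s Finset.sdiff_subset
    refine ⟨ψ, ⟨by rwa [← add_assoc], fun i hi => ?_⟩, fun A _ _ _ hA hm α β hβ => ?_⟩
    · have := hψf hi
      simp only [s, Finset.mem_sdiff, Finset.mem_image, Finset.mem_univ, true_and, not_and,
        not_not] at this
      exact this.2 (hθ.1 (θ.free_subset_vars this.1))
    · let M : FinStr.{u, v, w} L (Nat.card A) := ⟨A, rfl⟩
      have hβ' : ∀ i ∈ φ.freeNum, β i = numAsg A b i := by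
        intro i hi
        obtain ⟨j, rfl⟩ := hφκ hi
        refine Fin.ext ?_
        rw [hβ, coe_numAsg M b, Nat.mod_eq_of_lt] <;> simp only [b, hκ.extend_apply]
        exact Nat.lt_succ_of_le (hm j)
      have key : ∀ α' : ℕ → A, φ.Sat α' β ↔ θ.Sat α' := fun α' =>
        (LRecFormula.sat_congr φ (fun _ _ => rfl) hβ').trans
          ((hχs _ M α').trans (hθs A hA α').symm)
      rw [hψs]
      constructor
      · exact fun h => ⟨α, fun _ _ => rfl, (key α).1 h⟩
      -- Quantifying the variables in `s` does not change the meaning: `α'` agrees with `α` on the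
      -- free variables of `φ`, so `φ` has the same truth value under both.
      · rintro ⟨α', h1, h2⟩
        refine (LRecFormula.sat_congr φ (fun i hi => ?_) fun _ _ => rfl).1 ((key α').2 h2)
        obtain ⟨j, rfl⟩ := hφx hi
        exact h1 _ (by simp [s])
  choose ψ h1 h2 using main
  exact ⟨ψ, h1, fun A _ _ _ hA a m hm α β _ hβ => h2 m A hA hm α β hβ⟩
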